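/- Let $\mathbb D$ be the open unit disc and $H(\mathbb D)$ the space of analytic functions on $\mathbb D$. A \emph{normal weight} is a strictly positive, continuous function $\nu$ on $\mathbb D$ with $\nu(z)=\nu(|z|)$, non-increasing in $|z|$, such that $r\mapsto \nu(r)/(1-r^2)^{\beta}$ is almost increasing on $[0,1)$ for some $\beta>0$ and $r\mapsto\nu(r)/(1-r^2)^{\gamma}$ is almost decreasing on $[0,1)$ for some $\gamma>0$ (monotone up to a multiplicative constant). For a weight $w$ put $$\mathcal H^\infty_w=\Big\{f\in H(\mathbb D):\|f\|=\sup_{z\in\mathbb D}w(z)|f(z)|<\infty\Big\},\qquad \mathcal H^0_w=\Big\{f\in H(\mathbb D):\lim_{|z|\to1^-}w(z)|f(z)|=0\Big\},$$ both with the norm of $\mathcal H^\infty_w$. For $g\in H(\mathbb D)$ and an analytic self-map $\phi$ of $\mathbb D$ let $$(S_g^\phi f)(z)=\int_0^z f'(\phi(\zeta))\,g(\zeta)\,d\zeta,\qquad f\in H(\mathbb D),\ z\in\mathbb D.$$ Let $\nu,\mu$ be normal weights, $g\in H(\mathbb D)$, and $\phi$ an analytic self-map of $\mathbb D$ such that $S_g^\phi:\mathcal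 H^0_\nu\to\mathcal H^\infty_\mu$ is bounded. Then there are (unique) topological isomorphisms $\Phi_\nu:\mathcal H^\infty_\nu\to(\mathcal H^0_\nu)''$ and $\Phi_\mu:\mathcal H^\infty_\mu\to(\mathcal H^0_\mu)''$ with $\langle\Phi_\nu f,\delta_z\rangle=f(z)$ and $\langle\Phi_\mu f,\delta_z\rangle=f(z)$ for all $f$ and all $z\in\mathbb D$, where $\delta_z$ is evaluation at $z$; and, with $J:\mathcal H^\infty_\mu\to(\mathcal H^\infty_\mu)''$ the canonical embedding, the following hold. (i) The following are equivalent: (a) $S_g^\phi:\mathcal H^0_\nu\to\mathcal H^\infty_\mu$ is compact; (b) $S_g^\phi:\mathcal H^0_\nu\to\mathcal H^\infty_\mu$ is weakly compact; (c) the bi-transpose of $S_g^\phi:\mathcal H^0_\nu\to\mathcal H^\infty_\mu$ satisfies $(S_g^\phi)''=S_g^\phi$, that is, for every $f\in\mathcal H^\infty_\nu$ one has $S_g^\phi f\in\mathcal H^\infty_\mu$ and $(S_g^\phi)''(\Phi_\nu f)=J(S_g^\phi f)$. (ii) If $g\in\mathcal H^0_{(1-|z|^2)\mu(z)}$, then $S_g^\phi:\mathcal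 H^0_\nu\to\mathcal H^0_\mu$ is bounded and its bi-transpose satisfies $(S_g^\phi)''=S_g^\phi$, that is, for every $f\in\mathcal H^\infty_\nu$ one has $S_g^\phi f\in\mathcal H^\infty_\mu$ and $(S_g^\phi)''(\Phi_\nu f)=\Phi_\mu(S_g^\phi f)$. Moreover, $S_g^\phi:\mathcal H^0_\nu\to\mathcal H^0_\mu$ is compact if and only if $S_g^\phi(\mathcal H^\infty_\nu)\subset\mathcal H^0_\mu$. -/

import Mathlib

open Set Filter Topology Metric

noncomputable section

namespace VolterraComp

/-- The open unit disc `𝔻` of the complex plane. -/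
abbrev disc : Set ℂ := ball (0 : ℂ) 1

/-- `h` is almost increasing on `[0,1)`: `h r ≤ C h s` whenever `r ≤ s`. -/
def AlmostIncreasing (h : ℝ → ℝ) : Prop :=
  ∃ C : ℝ, 0 < C ∧ ∀ r s : ℝ, 0 ≤ r → r ≤ s → s < 1 → h r ≤ C * h s

/-- `h` is almost decreasing on `[0,1)`: `h s ≤ C h r` whenever `r ≤ s`. -/
def AlmostDecreasing (h : ℝ → ℝ) : Prop :=
  ∃ C : ℝ, 0 < C ∧ ∀ r s : ℝ, 0 ≤ r → r ≤ s → s < 1 → h s ≤ C * h r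

/-- Normal weights on the disc (in the sense of Shields and Williams).  Only the values on the
disc matter. -/
structure NormalWeight where
  toFun : ℂ → ℝ
  pos : ∀ z ∈ disc, 0 < toFun z
  continuousOn : ContinuousOn toFun disc
  radial : ∀ z ∈ disc, toFun z = toFun ((‖z‖ : ℝ) : ℂ)
  nonincreasing : ∀ r s : ℝ, 0 ≤ r → r ≤ s → s < 1 → toFun (s : ℂ) ≤ toFun (r : ℂ)
  normal_I : ∃ β : ℝ, 0 < β ∧ AlmostIncreasing (fun r => toFun (r : ℂ) / (1 - r ^ 2) ^ β)
  normal_II : ∃ γ : ℝ, 0 < γ ∧ AlmostDecreasing (fun r => toFun (r : ℂ) / (1 - r ^ 2) ^ γ)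

instance : CoeFun NormalWeight (fun _ => ℂ → ℝ) := ⟨NormalWeight.toFun⟩

/-- `f` is analytic on the disc and `sup_{z ∈ 𝔻} w(z)|f(z)| < ∞`. -/
def MemHinf (w : ℂ → ℝ) (f : ℂ → ℂ) : Prop :=
  DifferentiableOn ℂ f disc ∧ BddAbove (range fun z : disc => w z * ‖f z‖)

/-- `w(z)|f(z)| → 0` as `|z| → 1⁻`. -/
def VanishesAtBoundary (w : ℂ → ℝ) (f : ℂ → ℂ) : Prop :=
  Tendsto (fun z : ℂ => w z * ‖f z‖) (comap (fun z : ℂ => ‖z‖) (𝓝[<] 1)) (𝓝 0)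

/-- `f` is analytic on the disc and `w(z)|f(z)| → 0` as `|z| → 1⁻`. -/
def MemH0 (w : ℂ → ℝ) (f : ℂ → ℂ) : Prop :=
  DifferentiableOn ℂ f disc ∧ VanishesAtBoundary w f

/-- The vector space underlying `H^∞_ν`.  A function on the disc is represented by its extension
by zero to `ℂ`, so that two elements are equal iff they agree on the disc. -/
def HinfSubmodule (ν : NormalWeight) : Submodule ℂ (ℂ → ℂ) where
  carrier := {f | MemHinf ν f ∧ ∀ z ∉ disc, f z = 0}
  zero_mem' := by
    refine ⟨⟨differentiableOn_const 0, 0, ?_⟩, fun _ _ => rfl⟩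
    rintro _ ⟨z, rfl⟩
    simp
  add_mem' := by
    rintro f g ⟨⟨hf, A, hA⟩, hf0⟩ ⟨⟨hg, B, hB⟩, hg0⟩
    refine ⟨⟨hf.add hg, A + B, ?_⟩, fun z hz => by simp [hf0 z hz, hg0 z hz]⟩
    rintro _ ⟨z, rfl⟩
    have h1 := hA (mem_range_self z)
    have h2 := hB (mem_range_self z)
    have h3 := mul_le_mul_of_nonneg_left (norm_add_le (f z) (g z)) (ν.pos z z.2).le
    simp only [Pi.add_apply] at *
    linarith
  smul_mem' := by
    rintro c f ⟨⟨hf, A, hA⟩, hf0⟩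
    refine ⟨⟨hf.const_smul c, ‖c‖ * A, ?_⟩, fun z hz => by simp [hf0 z hz]⟩
    rintro _ ⟨z, rfl⟩
    have h1 := mul_le_mul_of_nonneg_left (hA (mem_range_self z)) (norm_nonneg c)
    simp only [Pi.smul_apply, norm_smul] at *
    linarith

/-- The weighted space `H^∞_ν`.  (A separate type, so that it carries the weighted sup norm and not
the topology of pointwise convergence.) -/
def Hinf (ν : NormalWeight) : Type := HinfSubmodule ν

variable {ν : NormalWeight}

instance : AddCommGroup (Hinf ν) := inferInstanceAs (AddCommGroup (HinfSubmodule ν))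

instance : Module ℂ (Hinf ν) := inferInstanceAs (Module ℂ (HinfSubmodule ν))

instance : CoeFun (Hinf ν) (fun _ => ℂ → ℂ) := ⟨fun f => f.1⟩

theorem Hinf.zero_apply (z : ℂ) : (0 : Hinf ν) z = 0 := rfl

theorem Hinf.add_apply (f g : Hinf ν) (z : ℂ) : (f + g) z = f z + g z := rfl

theorem Hinf.neg_apply (f : Hinf ν) (z : ℂ) : (-f) z = - f z := rfl

theorem Hinf.smul_apply (c : ℂ) (f : Hinf ν) (z : ℂ) : (c • f) z = c * f z := rfl

theorem Hinf.ext {f g : Hinf ν} (h : ∀ z ∈ disc, f z = g z) : f = g := by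
  refine Subtype.ext (funext fun z => ?_)
  by_cases hz : z ∈ disc
  · exact h z hz
  · exact (f.2.2 z hz).trans (g.2.2 z hz).symm

/-- The norm `‖f‖ = sup_{z ∈ 𝔻} ν(z)|f(z)|`. -/
instance : Norm (Hinf ν) := ⟨fun f => ⨆ z : disc, ν z * ‖f z‖⟩

theorem Hinf.norm_def (f : Hinf ν) : ‖f‖ = ⨆ z : disc, ν z * ‖f z‖ := rfl

theorem Hinf.le_norm (f : Hinf ν) {z : ℂ} (hz : z ∈ disc) : ν z * ‖f z‖ ≤ ‖f‖ :=
  le_ciSup f.2.1.2 (⟨z, hz⟩ : disc)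

instance : Nonempty disc := ⟨⟨0, by simp⟩⟩

theorem Hinf.norm_le {f : Hinf ν} {C : ℝ} (h : ∀ z ∈ disc, ν z * ‖f z‖ ≤ C) : ‖f‖ ≤ C :=
  ciSup_le fun z : disc => h z z.2

theorem Hinf.norm_nonneg' (f : Hinf ν) : 0 ≤ ‖f‖ :=
  (mul_nonneg (ν.pos 0 (by simp)).le (norm_nonneg _)).trans (f.le_norm (z := 0) (by simp))

instance : NormedAddCommGroup (Hinf ν) :=
  AddGroupNorm.toNormedAddCommGroup
    { toFun := fun f => ‖f‖
      map_zero' := le_antisymm (Hinf.norm_le fun z _ => by simp [Hinf.zero_apply])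
        (Hinf.norm_nonneg' _)
      add_le' := fun f g => Hinf.norm_le fun z hz => by
        have h1 := f.le_norm hz
        have h2 := g.le_norm hz
        have h3 := mul_le_mul_of_nonneg_left (norm_add_le (f z) (g z)) (ν.pos z hz).le
        rw [Hinf.add_apply]
        linarith
      neg' := fun f => by simp [Hinf.norm_def, Hinf.neg_apply]
      eq_zero_of_map_eq_zero' := fun f hf => Hinf.ext fun z hz => by
        have h1 := f.le_norm hz
        have h2 : ‖f‖ = 0 := hf
        have h3 := ν.pos z hz
        rw [h2] at h1
        have h4 : ‖f z‖ ≤ 0 := by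
          by_contra! h
          exact absurd h1 (not_le.mpr (mul_pos h3 h))
        rw [Hinf.zero_apply]
        exact norm_le_zero_iff.mp h4 }

instance : NormedSpace ℂ (Hinf ν) where
  norm_smul_le := fun c f => Hinf.norm_le fun z hz => by
    have h1 := mul_le_mul_of_nonneg_left (f.le_norm hz) (norm_nonneg c)
    rw [Hinf.smul_apply, norm_mul]
    linarith

/-- The little weighted space `H^0_ν`, with the norm of `H^∞_ν`. -/
def H0 (ν : NormalWeight) : Submodule ℂ (Hinf ν) where
  carrier := {f | VanishesAtBoundary ν f}
  zero_mem' := by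
    simp only [mem_ofPred_eq, VanishesAtBoundary, Hinf.zero_apply, norm_zero, mul_zero]
    exact tendsto_const_nhds
  add_mem' := by
    intro f g hf hg
    have h : Tendsto (fun z : ℂ => ν z * ‖f z‖ + ν z * ‖g z‖)
        (comap (fun z : ℂ => ‖z‖) (𝓝[<] 1)) (𝓝 0) := by simpa using hf.add hg
    have hev : ∀ᶠ z : ℂ in comap (fun z : ℂ => ‖z‖) (𝓝[<] 1), z ∈ disc := by
      refine eventually_comap.mpr ?_
      filter_upwards [self_mem_nhdsWithin] with r hr z hz
      simpa [hz] using hr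
    refine squeeze_zero' ?_ ?_ h
    · filter_upwards [hev] with z hz
      exact mul_nonneg (ν.pos z hz).le (norm_nonneg _)
    · filter_upwards [hev] with z hz
      rw [← mul_add, Hinf.add_apply]
      exact mul_le_mul_of_nonneg_left (norm_add_le _ _) (ν.pos z hz).le
  smul_mem' := by
    intro c f hf
    have h := Tendsto.const_mul ‖c‖ (show Tendsto _ _ _ from hf)
    rw [mul_zero] at h
    refine h.congr fun z => ?_
    rw [Hinf.smul_apply, norm_mul]
    ring

/-- The point evaluation `δ_z : f ↦ f(z)` as a bounded functional on `H^0_ν`. -/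
def pointEval (ν : NormalWeight) (z : disc) : StrongDual ℂ (H0 ν) :=
  LinearMap.mkContinuous
    { toFun := fun f : H0 ν => (f : Hinf ν) (z : ℂ)
      map_add' := fun _ _ => rfl
      map_smul' := fun _ _ => rfl }
    (ν z)⁻¹
    (fun f => by
      have h1 := (f : Hinf ν).le_norm z.2
      rw [inv_mul_eq_div, le_div_iff₀ (ν.pos z z.2), mul_comm]
      exact h1)

/-- The Volterra composition operator `(S_g^φ f)(z) = ∫_0^z f'(φ(ζ)) g(ζ) dζ`, the integral being
taken along the segment from `0` to `z`. -/
def volterraS (g φ f : ℂ → ℂ) (z : ℂ) : ℂ :=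
  ∫ t in (0 : ℝ)..1, z * (deriv f (φ (t * z)) * g (t * z))

section Operators

variable {E F : Type*} [NormedAddCommGroup E] [NormedSpace ℂ E]
  [NormedAddCommGroup F] [NormedSpace ℂ F]

/-- The transpose `T' : F' → E'`, `ℓ ↦ ℓ ∘ T`. -/
def transpose (T : E →L[ℂ] F) : StrongDual ℂ F →L[ℂ] StrongDual ℂ E :=
  (ContinuousLinearMap.compL ℂ E F ℂ).flip T

/-- The bi-transpose `T'' : E'' → F''`. -/
def bitranspose (T : E →L[ℂ] F) :
    StrongDual ℂ (StrongDual ℂ E) →L[ℂ] StrongDual ℂ (StrongDual ℂ F) :=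
  transpose (transpose T)

/-- `T` is weakly compact: the image of the closed unit ball is relatively compact in the weak
topology. -/
def IsWeaklyCompactOperator (T : E →L[ℂ] F) : Prop :=
  IsCompact (closure (toWeakSpace ℂ F '' (T '' closedBall (0 : E) 1)))

end Operators

/-- `Φ` is the canonical identification of `H^∞_ν` with the bidual of `H^0_ν`, i.e. the one with
`⟨Φ f, δ_z⟩ = f(z)`.  As `Φ` is onto, there is at most one such `Φ`. -/
def IsCanonicalBidual (Φ : Hinf ν ≃L[ℂ] StrongDual ℂ (StrongDual ℂ (H0 ν))) : Prop :=
  ∀ (f : Hinf ν) (z : disc), Φ f (pointEval ν z) = f z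

end VolterraComp

end

/-!
Everything rests on the dilations `f_r = f (r ·)`. They are contractions of `H^∞_ν` into `H^0_ν`,
and each of them is an absolutely convergent series of rank one operators `f ↦ r ^ k c_k(f) z ^ k`.

*Weakly compact operators on `H^0_ν` are compact.* If `f_n` is bounded and tends to `0` locally
uniformly, then along a subsequence the weighted functions are concentrated on essentially disjoint
annuli, so that the partial sums of all its signed subseries are uniformly bounded. A weakly compact
`T` sends such a sequence to a null sequence: otherwise, disjointification by Rosenthal's lemma
would contradict the double limit criterion. Applied to `f_n - (f_n)_r` with `r → 1`, this gives
`T (f_r) → T f` uniformly on the unit ball, and `T` is a norm limit of compact operators.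

*The bidual.* Applied to functionals, the same argument shows that the coefficient functionals
span a dense subspace of `(H^0_ν)'`. Hence `x ↦ (z ↦ ⟨x, δ_z⟩)` is an isometry of `(H^0_ν)''` into
`H^∞_ν`, which is onto by weak-* compactness, and `f_r → f` weak-*. So the bi-transpose of `S_g^φ`
is determined by its values on dilations, where `S_g^φ` is given by the integral.

*Part (ii).* The growth condition on `g` gives `(1 - |z|²) μ(z) |(S_g^φ z^k)'| → 0`, which
integrates along rays to `S_g^φ z^k ∈ H^0_μ` because `μ(r) / (1 - r²)^γ` is almost decreasing.
-/

noncomputable section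

set_option maxSynthPendingDepth 3

namespace VolterraComp

/-- Rosenthal's lemma for nonnegative matrices. -/
theorem exists_injective_sum_erase_le {a : ℕ → ℕ → ℝ} (ha : ∀ j k, 0 ≤ a j k) {M : ℝ}
    (hM : ∀ j (s : Finset ℕ), ∑ k ∈ s, a j k ≤ M) {ε : ℝ} (hε : 0 < ε) :
    ∃ σ : ℕ → ℕ, Function.Injective σ ∧
      ∀ j (s : Finset ℕ), ∑ k ∈ s.erase j, a (σ j) (σ k) ≤ ε := by
  obtain ⟨m, hm⟩ := exists_nat_ge (M / ε)
  replace hM : ∀ j (s : Finset ℕ), ∑ k ∈ s, a j k ≤ m * ε := fun j s =>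
    (hM j s).trans ((div_le_iff₀ hε).mp hm)
  clear hm
  induction m generalizing a with
  | zero =>
    refine ⟨id, Function.injective_id, fun j s => (hM _ _).trans ?_⟩
    simpa using hε.le
  | succ m ih =>
    -- Split the indices into the infinite rows `{⟨p, k⟩ | k}`: either one of them works, or a
    -- transversal through all of them has row sums smaller by `ε`.
    by_cases h : ∃ p, ∀ q (s : Finset ℕ), ∑ k ∈ s.erase q, a (Nat.pair p q) (Nat.pair p k) ≤ ε
    · obtain ⟨p, hp⟩ := h
      exact ⟨Nat.pair p, fun x y hxy => (Nat.pair_eq_pair.mp hxy).2, hp⟩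
    push Not at h
    choose q s hqs using h
    have hinj : Function.Injective fun p => Nat.pair p (q p) :=
      fun x y hxy => (Nat.pair_eq_pair.mp hxy).1
    have htransversal : ∀ p (t : Finset ℕ),
        ∑ i ∈ t, a (Nat.pair p (q p)) (Nat.pair i (q i)) ≤ m * ε := fun p t => by
      have hdisj : Disjoint (t.image fun i => Nat.pair i (q i))
          (((s p).erase (q p)).image (Nat.pair p)) := by
        rw [Finset.disjoint_left]
        intro x hx hx'
        obtain ⟨i, -, rfl⟩ := Finset.mem_image.mp hx
        obtain ⟨k, hk, hk'⟩ := Finset.mem_image.mp hx'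
        obtain ⟨rfl, rfl⟩ := Nat.pair_eq_pair.mp hk'
        exact Finset.notMem_erase _ _ hk
      have htotal := hM (Nat.pair p (q p))
        ((t.image fun i => Nat.pair i (q i)) ∪ (((s p).erase (q p)).image (Nat.pair p)))
      rw [Finset.sum_union hdisj, Finset.sum_image (fun x _ y _ hxy => hinj hxy),
        Finset.sum_image (fun x _ y _ hxy => (Nat.pair_eq_pair.mp hxy).2)] at htotal
      push_cast at htotal
      linarith [hqs p]
    obtain ⟨τ, hτ, hτs⟩ := ih (fun _ _ => ha _ _) htransversal
    exact ⟨fun p => Nat.pair (τ p) (q (τ p)), hinj.comp hτ, hτs⟩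

section WeaklyCompact

variable {E F : Type*} [NormedAddCommGroup E] [NormedSpace ℂ E]
  [NormedAddCommGroup F] [NormedSpace ℂ F] {T : E →L[ℂ] F}

theorem bitranspose_apply (T : E →L[ℂ] F) (x : StrongDual ℂ (StrongDual ℂ E))
    (l : StrongDual ℂ F) : bitranspose T x l = x (transpose T l) := rfl

theorem isWeaklyCompactOperator_of_isCompactOperator (hT : IsCompactOperator T) :
    IsWeaklyCompactOperator T := by
  obtain ⟨K, hK, hTK⟩ := IsCompactOperator.image_closedBall_subset_compact
    (f := (T : E →ₗ[ℂ] F)) hT 1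
  have hK' : IsCompact (toWeakSpace ℂ F '' K) := hK.image (toWeakSpaceCLM ℂ F).continuous
  exact hK'.of_isClosed_subset isClosed_closure
    (closure_minimal (image_mono hTK) hK'.isClosed)

/-- By Banach–Alaoglu, `T''` maps the unit ball of `E''` onto a weak-star compact set, which by
assumption lies in the weakly embedded copy of `F`. -/
theorem isWeaklyCompactOperator_of_bitranspose_mem_range
    (hT : ∀ x, bitranspose T x ∈ range (NormedSpace.inclusionInDoubleDual ℂ F)) :
    IsWeaklyCompactOperator T := by
  let B : Set (WeakDual ℂ (StrongDual ℂ E)) :=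
    WeakDual.toStrongDual ⁻¹' closedBall (0 : StrongDual ℂ (StrongDual ℂ E)) 1
  let A : WeakDual ℂ (StrongDual ℂ E) → WeakDual ℂ (StrongDual ℂ F) :=
    fun x => StrongDual.toWeakDual (bitranspose T (WeakDual.toStrongDual x))
  have hA : Continuous A := WeakDual.continuous_of_continuous_eval fun l =>
    WeakDual.eval_continuous (transpose T l)
  have hAB : IsCompact (A '' B) := (WeakDual.isCompact_closedBall _ _).image hA
  have hrange : A '' B ⊆ range (NormedSpace.inclusionInDoubleDualWeak ℂ F) := by
    rintro _ ⟨x, -, rfl⟩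
    obtain ⟨y, hy⟩ := hT (WeakDual.toStrongDual x)
    exact ⟨toWeakSpace ℂ F y, congrArg StrongDual.toWeakDual hy⟩
  have hK := ((NormedSpace.isEmbedding_inclusionInDoubleDualWeak ℂ
    F).isInducing.isCompact_preimage_iff hrange).mpr hAB
  refine hK.of_isClosed_subset isClosed_closure (closure_minimal ?_ hK.isClosed)
  rintro _ ⟨_, ⟨x, hx, rfl⟩, rfl⟩
  refine ⟨StrongDual.toWeakDual (NormedSpace.inclusionInDoubleDual ℂ E x), ?_, rfl⟩
  exact (mem_closedBall_zero_iff (E := StrongDual ℂ (StrongDual ℂ E))).mpr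
    ((NormedSpace.double_dual_bound ℂ E x).trans (mem_closedBall_zero_iff.mp hx))

theorem IsWeaklyCompactOperator.exists_mapClusterPt (hT : IsWeaklyCompactOperator T)
    {x : ℕ → E} {R : ℝ} (hx : ∀ n, ‖x n‖ ≤ R) :
    ∃ y : F, MapClusterPt (toWeakSpace ℂ F y) atTop fun n => toWeakSpace ℂ F (T (x n)) := by
  have hR : 0 < R + 1 := by linarith [(norm_nonneg _).trans (hx 0)]
  have hc : ((R + 1 : ℝ) : ℂ) ≠ 0 := Complex.ofReal_ne_zero.mpr hR.ne'
  have hball : ∀ n, ((R + 1 : ℝ) : ℂ)⁻¹ • x n ∈ closedBall (0 : E) 1 := fun n => by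
    rw [mem_closedBall_zero_iff, norm_smul, norm_inv, Complex.norm_real,
      Real.norm_of_nonneg hR.le, inv_mul_le_iff₀ hR]
    linarith [hx n]
  obtain ⟨y, -, hy⟩ := IsCompact.exists_mapClusterPt hT (f := atTop)
    (u := fun n => toWeakSpace ℂ F (T (((R + 1 : ℝ) : ℂ)⁻¹ • x n))) (by
      rw [le_principal_iff]
      exact Filter.mem_map.mpr (Eventually.of_forall fun n =>
        subset_closure ⟨_, ⟨_, hball n, rfl⟩, rfl⟩))
  refine ⟨(toWeakSpace ℂ F).symm (((R + 1 : ℝ) : ℂ) • y), ?_⟩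
  rw [LinearEquiv.apply_symm_apply]
  convert hy.continuousAt_comp (continuous_const_smul ((R + 1 : ℝ) : ℂ)).continuousAt using 1
  ext n : 1
  rw [Function.comp_apply, ← map_smul (toWeakSpace ℂ F), ← map_smul T, smul_inv_smul₀ hc]

/-- Grothendieck's double limit criterion. -/
theorem IsWeaklyCompactOperator.le_of_double_limit (hT : IsWeaklyCompactOperator T)
    {x : ℕ → E} {R : ℝ} (hx : ∀ n, ‖x n‖ ≤ R) {l : ℕ → StrongDual ℂ F} {M : ℝ}
    (hl : ∀ j, ‖l j‖ ≤ M) {a b : ℝ} (ha : ∀ j n, j < n → a ≤ (l j (T (x n))).re)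
    (hb : ∀ j n, n ≤ j → (l j (T (x n))).re ≤ b) : a ≤ b := by
  obtain ⟨y, hy⟩ := hT.exists_mapClusterPt hx
  obtain ⟨m, -, hm⟩ := (WeakDual.isCompact_closedBall (𝕜 := ℂ) (0 : StrongDual ℂ F)
    M).exists_mapClusterPt (f := atTop) (u := fun j => StrongDual.toWeakDual (l j)) (by
      rw [le_principal_iff]
      exact Filter.mem_map.mpr (Eventually.of_forall fun j => by simpa using hl j))
  have hweak : ∀ k : StrongDual ℂ F, Continuous fun v : WeakSpace ℂ F =>
      (k ((toWeakSpace ℂ F).symm v)).re := fun k =>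
    Complex.continuous_re.comp (WeakBilin.eval_continuous _ k)
  have hweakStar : ∀ v : F, Continuous fun k : WeakDual ℂ F => (k v).re := fun v =>
    Complex.continuous_re.comp (WeakDual.eval_continuous v)
  have hay : ∀ j, a ≤ (l j y).re := fun j =>
    (isClosed_le continuous_const (hweak (l j))).mem_of_mapClusterPt hy
      ((eventually_gt_atTop j).mono (ha j))
  have ham : a ≤ (m y).re :=
    (isClosed_le continuous_const (hweakStar y)).mem_of_mapClusterPt hm (Eventually.of_forall hay)
  have hmb : ∀ n, (m (T (x n))).re ≤ b := fun n =>
    (isClosed_le (hweakStar _) continuous_const).mem_of_mapClusterPt hm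
      ((eventually_ge_atTop n).mono fun j hj => hb j n hj)
  exact ham.trans ((isClosed_le (hweak (WeakDual.toStrongDual m))
    continuous_const).mem_of_mapClusterPt hy (Eventually.of_forall hmb))

end WeaklyCompact

section WeaklyUnconditionallyBounded

variable {E F : Type*} [NormedAddCommGroup E] [NormedSpace ℂ E]
  [NormedAddCommGroup F] [NormedSpace ℂ F] {u : ℕ → E} {C : ℝ}

/-- The finite sums `∑ c_k u_k` with `|c_k| ≤ 1` are bounded by `C`, that is, the series `∑ u_k` is
weakly unconditionally Cauchy, with an explicit bound. -/
def IsWeaklyUnconditionallyBounded (u : ℕ → E) (C : ℝ) : Prop :=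
  ∀ (s : Finset ℕ) (c : ℕ → ℂ), (∀ k, ‖c k‖ ≤ 1) → ‖∑ k ∈ s, c k • u k‖ ≤ C

namespace IsWeaklyUnconditionallyBounded

theorem norm_sum_le (hu : IsWeaklyUnconditionallyBounded u C) (s : Finset ℕ) :
    ‖∑ k ∈ s, u k‖ ≤ C := by
  simpa using hu s 1 (by simp)

theorem bound_nonneg (hu : IsWeaklyUnconditionallyBounded u C) : 0 ≤ C := by
  simpa using hu.norm_sum_le ∅

theorem comp_injective (hu : IsWeaklyUnconditionallyBounded u C) {σ : ℕ → ℕ}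
    (hσ : Function.Injective σ) : IsWeaklyUnconditionallyBounded (u ∘ σ) C := fun s c hc => by
  have h := hu (s.image σ) (c ∘ Function.invFun σ) fun k => hc _
  rw [Finset.sum_image fun x _ y _ h => hσ h] at h
  simpa only [Function.comp_apply, Function.leftInverse_invFun hσ _] using h

theorem sum_norm_apply_le (hu : IsWeaklyUnconditionallyBounded u C) (l : StrongDual ℂ E)
    (s : Finset ℕ) : ∑ k ∈ s, ‖l (u k)‖ ≤ ‖l‖ * C := by
  have hphase : ∀ k, ∃ c : ℂ, ‖c‖ ≤ 1 ∧ c * l (u k) = ‖l (u k)‖ := fun k => by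
    by_cases h : l (u k) = 0
    · exact ⟨0, by simp, by simp [h]⟩
    · refine ⟨‖l (u k)‖ / l (u k), ?_, by field_simp⟩
      rw [norm_div, Complex.norm_real, norm_norm]
      exact div_self_le_one _
  choose c hc hcl using hphase
  have hsum : l (∑ k ∈ s, c k • u k) = ((∑ k ∈ s, ‖l (u k)‖ : ℝ) : ℂ) := by
    simp only [map_sum, map_smul, smul_eq_mul, hcl, Complex.ofReal_sum]
  calc ∑ k ∈ s, ‖l (u k)‖ = ‖l (∑ k ∈ s, c k • u k)‖ := by
        rw [hsum, Complex.norm_real,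
          Real.norm_of_nonneg (Finset.sum_nonneg fun _ _ => norm_nonneg _)]
    _ ≤ ‖l‖ * ‖∑ k ∈ s, c k • u k‖ := l.le_opNorm _
    _ ≤ ‖l‖ * C := mul_le_mul_of_nonneg_left (hu s c hc) (norm_nonneg _)

theorem exists_injective_sum_erase_norm_apply_le (hu : IsWeaklyUnconditionallyBounded u C)
    {l : ℕ → StrongDual ℂ E} {M : ℝ} (hl : ∀ j, ‖l j‖ ≤ M) {ε : ℝ} (hε : 0 < ε) :
    ∃ σ : ℕ → ℕ, Function.Injective σ ∧
      ∀ j (s : Finset ℕ), ∑ k ∈ s.erase j, ‖l (σ j) (u (σ k))‖ ≤ ε :=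
  exists_injective_sum_erase_le (fun _ _ => norm_nonneg _)
    (fun j s => (hu.sum_norm_apply_le (l j) s).trans
      (mul_le_mul_of_nonneg_right (hl j) hu.bound_nonneg)) hε

/-- If `‖T u_k‖ ≥ ε` for all `k`, norming functionals of the `T u_k`, thinned out by Rosenthal's
lemma, and the partial sums of `∑ u_k` violate the double limit criterion. -/
theorem exists_norm_apply_lt (hu : IsWeaklyUnconditionallyBounded u C) {T : E →L[ℂ] F}
    (hT : IsWeaklyCompactOperator T) {ε : ℝ} (hε : 0 < ε) : ∃ k, ‖T (u k)‖ < ε := by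
  by_contra! hbig
  choose l hl hlu using fun k => exists_dual_vector'' ℂ (T (u k))
  have hlT : ∀ j, ‖(l j).comp T‖ ≤ ‖T‖ := fun j =>
    ((l j).opNorm_comp_le T).trans (mul_le_of_le_one_left (norm_nonneg _) (hl j))
  obtain ⟨σ, hσ, hoff⟩ :=
    hu.exists_injective_sum_erase_norm_apply_le hlT (ε := ε / 4) (by positivity)
  have hre : ∀ j n, (l (σ j) (T (∑ k ∈ Finset.range n, u (σ k)))).re =
      ∑ k ∈ Finset.range n, (l (σ j) (T (u (σ k)))).re := fun j n => by
    simp only [map_sum, Complex.re_sum]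
  have hoff' : ∀ j (s : Finset ℕ), |∑ k ∈ s.erase j, (l (σ j) (T (u (σ k)))).re| ≤ ε / 4 :=
    fun j s => (Finset.abs_sum_le_sum_abs _ _).trans
      ((Finset.sum_le_sum fun k _ => Complex.abs_re_le_norm _).trans (hoff j s))
  have hcontra : 3 * ε / 4 ≤ ε / 4 := by
    refine hT.le_of_double_limit (fun n => (hu.comp_injective hσ).norm_sum_le (Finset.range n))
      (fun j => hl (σ j)) (fun j n hjn => ?_) fun j n hnj => ?_
    · have hdiag : ε ≤ (l (σ j) (T (u (σ j)))).re := by simpa [hlu] using hbig (σ j)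
      simp only [Function.comp_apply]
      rw [hre, ← Finset.add_sum_erase _ _ (Finset.mem_range.mpr hjn)]
      linarith [(abs_le.mp (hoff' j (Finset.range n))).1]
    · simp only [Function.comp_apply]
      rw [hre, ← Finset.erase_eq_of_notMem (by simpa using hnj : j ∉ Finset.range n)]
      exact (abs_le.mp (hoff' j (Finset.range n))).2
  linarith

theorem tendsto_apply (hu : IsWeaklyUnconditionallyBounded u C) {T : E →L[ℂ] F}
    (hT : IsWeaklyCompactOperator T) : Tendsto (fun k => T (u k)) atTop (𝓝 0) := by
  rw [NormedAddGroup.tendsto_nhds_zero]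
  intro ε hε
  by_contra h
  obtain ⟨σ, hσ, hσε⟩ := extraction_of_frequently_atTop (not_eventually.mp h)
  obtain ⟨k, hk⟩ := (hu.comp_injective hσ.injective).exists_norm_apply_lt hT hε
  exact hσε k hk

end IsWeaklyUnconditionallyBounded

end WeaklyUnconditionallyBounded

section Weights

theorem mem_disc {z : ℂ} : z ∈ disc ↔ ‖z‖ < 1 := mem_ball_zero_iff

theorem ofReal_mem_disc {r : ℝ} (h0 : 0 ≤ r) (h1 : r < 1) : (r : ℂ) ∈ disc := by
  rwa [mem_disc, Complex.norm_real, Real.norm_of_nonneg h0]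

namespace NormalWeight

theorem le_of_norm_le (ν : NormalWeight) {z w : ℂ} (hz : z ∈ disc) (h : ‖w‖ ≤ ‖z‖) :
    ν z ≤ ν w := by
  have hz' := mem_disc.mp hz
  rw [ν.radial z hz, ν.radial w (mem_disc.mpr (h.trans_lt hz'))]
  exact ν.nonincreasing _ _ (norm_nonneg _) h hz'

theorem pos_ofReal (ν : NormalWeight) {r : ℝ} (h0 : 0 ≤ r) (h1 : r < 1) : 0 < ν r :=
  ν.pos _ (ofReal_mem_disc h0 h1)

end NormalWeight

theorem eventually_boundary_iff {P : ℂ → Prop} :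
    (∀ᶠ z in comap (fun z : ℂ => ‖z‖) (𝓝[<] 1), P z) ↔
      ∃ R : ℝ, 0 ≤ R ∧ R < 1 ∧ ∀ z ∈ disc, R < ‖z‖ → P z := by
  rw [eventually_comap]
  constructor
  · intro h
    obtain ⟨R, hR, hR'⟩ := (mem_nhdsLT_iff_exists_Ioo_subset' (show (0 : ℝ) < 1 by norm_num)).mp h
    refine ⟨max R 0, le_max_right _ _, max_lt hR (by norm_num), fun z hz hRz => ?_⟩
    exact hR' ⟨(le_max_left _ _).trans_lt hRz, mem_disc.mp hz⟩ z rfl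
  · rintro ⟨R, -, hR1, h⟩
    filter_upwards [Ioo_mem_nhdsLT hR1] with r hr z hz
    exact h z (by rw [mem_disc, hz]; exact hr.2) (by rw [hz]; exact hr.1)

theorem eventually_boundary_of_forall_mem_disc {P : ℂ → Prop} (h : ∀ z ∈ disc, P z) :
    ∀ᶠ z in comap (fun z : ℂ => ‖z‖) (𝓝[<] 1), P z :=
  eventually_boundary_iff.mpr ⟨0, le_rfl, one_pos, fun z hz _ => h z hz⟩

theorem vanishesAtBoundary_iff {w : ℂ → ℝ} (hw : ∀ z ∈ disc, 0 ≤ w z) {f : ℂ → ℂ} :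
    VanishesAtBoundary w f ↔ ∀ ε > 0, ∃ R : ℝ, 0 ≤ R ∧ R < 1 ∧
      ∀ z ∈ disc, R < ‖z‖ → w z * ‖f z‖ < ε := by
  have habs : ∀ z ∈ disc, dist (w z * ‖f z‖) 0 = w z * ‖f z‖ := fun z hz => by
    rw [Real.dist_0_eq_abs, abs_of_nonneg (mul_nonneg (hw z hz) (norm_nonneg _))]
  simp only [VanishesAtBoundary, Metric.tendsto_nhds, eventually_boundary_iff]
  refine forall₂_congr fun ε _ => exists_congr fun R => and_congr_right fun _ =>
    and_congr_right fun _ => forall₂_congr fun z hz => ?_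
  rw [habs z hz]

theorem VanishesAtBoundary.of_le {v w : ℂ → ℝ} {f g : ℂ → ℂ} (hg : VanishesAtBoundary v g)
    (hw : ∀ z ∈ disc, 0 ≤ w z) {C : ℝ} (h : ∀ z ∈ disc, w z * ‖f z‖ ≤ C * (v z * ‖g z‖)) :
    VanishesAtBoundary w f :=
  squeeze_zero' (eventually_boundary_of_forall_mem_disc fun z hz =>
      mul_nonneg (hw z hz) (norm_nonneg _))
    (eventually_boundary_of_forall_mem_disc h) (by simpa using Tendsto.const_mul C hg)

theorem VanishesAtBoundary.congr {w : ℂ → ℝ} {f h : ℂ → ℂ} (hf : VanishesAtBoundary w f)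
    (hfh : EqOn f h disc) : VanishesAtBoundary w h :=
  Tendsto.congr' (eventually_boundary_of_forall_mem_disc fun z hz =>
    congrArg (fun x => w z * ‖x‖) (hfh hz)) hf

namespace NormalWeight

theorem vanishesAtBoundary_one (ν : NormalWeight) : VanishesAtBoundary ν fun _ => 1 := by
  obtain ⟨γ, hγ, C, -, h⟩ := ν.normal_II
  have hlim : Tendsto (fun r : ℝ => C * ν 0 * (1 - r ^ 2) ^ γ) (𝓝[<] 1) (𝓝 0) := by
    have hcont : Continuous fun r : ℝ => C * ν 0 * (1 - r ^ 2) ^ γ :=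
      continuous_const.mul ((continuous_const.sub (continuous_pow 2)).rpow_const
        fun _ => Or.inr hγ.le)
    simpa [Real.zero_rpow hγ.ne'] using
      (hcont.tendsto 1).mono_left (nhdsWithin_le_nhds (s := Iio 1))
  refine squeeze_zero' (eventually_boundary_of_forall_mem_disc fun z hz => ?_)
    (eventually_boundary_of_forall_mem_disc fun z hz => ?_)
    (hlim.comp (tendsto_comap (f := fun z : ℂ => ‖z‖)))
  · simpa using (ν.pos z hz).le
  · have hpos : 0 < 1 - ‖z‖ ^ 2 := by nlinarith [norm_nonneg z, mem_disc.mp hz]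
    have hdecr := h 0 ‖z‖ le_rfl (norm_nonneg _) (mem_disc.mp hz)
    rw [div_le_iff₀ (Real.rpow_pos_of_pos hpos _), ← ν.radial z hz] at hdecr
    simpa using hdecr

theorem vanishesAtBoundary_of_norm_le (ν : NormalWeight) {f : ℂ → ℂ} {B : ℝ}
    (hf : ∀ z ∈ disc, ‖f z‖ ≤ B) : VanishesAtBoundary ν f :=
  ν.vanishesAtBoundary_one.of_le (C := B) (fun z hz => (ν.pos z hz).le) fun z hz => by
    rw [norm_one, mul_one, mul_comm B]
    exact mul_le_mul_of_nonneg_left (hf z hz) (ν.pos z hz).le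

end NormalWeight

end Weights

section Dilation

variable {ν : NormalWeight}

namespace Hinf

theorem sub_apply (f g : Hinf ν) (z : ℂ) : (f - g) z = f z - g z := by
  rw [sub_eq_add_neg, add_apply, neg_apply, ← sub_eq_add_neg]

theorem sum_apply {ι : Type*} (s : Finset ι) (f : ι → Hinf ν) (z : ℂ) :
    (∑ i ∈ s, f i) z = ∑ i ∈ s, f i z := by
  classical
  induction s using Finset.induction_on with
  | empty => simp only [Finset.sum_empty, zero_apply]
  | insert i s hi ih => rw [Finset.sum_insert hi, Finset.sum_insert hi, add_apply, ih]

theorem differentiableOn (f : Hinf ν) : DifferentiableOn ℂ f disc := f.2.1.1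

theorem norm_apply_le (f : Hinf ν) {z : ℂ} {R : ℝ} (hR : R < 1) (hz : ‖z‖ ≤ R) :
    ‖f z‖ ≤ ‖f‖ / ν R := by
  have h0 : 0 ≤ R := (norm_nonneg z).trans hz
  rw [le_div_iff₀ (ν.pos_ofReal h0 hR), mul_comm]
  refine le_trans ?_ (f.le_norm (mem_disc.mpr (hz.trans_lt hR)))
  refine mul_le_mul_of_nonneg_right (ν.le_of_norm_le (ofReal_mem_disc h0 hR) ?_) (norm_nonneg _)
  rwa [Complex.norm_real, Real.norm_of_nonneg h0]

/-- The element of `H^∞_ν` given by an analytic function with a weighted bound, extended by zero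
off the disc. -/
def ofBound (f : ℂ → ℂ) (hf : DifferentiableOn ℂ f disc) (C : ℝ)
    (hC : ∀ z ∈ disc, ν z * ‖f z‖ ≤ C) : Hinf ν :=
  ⟨disc.indicator f, ⟨hf.congr fun z hz => indicator_of_mem hz f, C, by
    rintro _ ⟨z, rfl⟩
    simpa only [indicator_of_mem z.2] using hC z z.2⟩, fun z hz => indicator_of_notMem hz f⟩

theorem ofBound_apply {f : ℂ → ℂ} (hf : DifferentiableOn ℂ f disc) {C : ℝ}
    (hC : ∀ z ∈ disc, ν z * ‖f z‖ ≤ C) {z : ℂ} (hz : z ∈ disc) : ofBound f hf C hC z = f z :=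
  indicator_of_mem hz f

end Hinf

theorem H0.norm_le {f : H0 ν} {C : ℝ} (h : ∀ z ∈ disc, ν z * ‖(f : Hinf ν) z‖ ≤ C) : ‖f‖ ≤ C :=
  Hinf.norm_le h

variable (r : Ico (0 : ℝ) 1) {z : ℂ}

theorem norm_dilate_eq : ‖(r : ℂ) * z‖ = r * ‖z‖ := by
  rw [norm_mul, Complex.norm_real, Real.norm_of_nonneg r.2.1]

theorem norm_dilate_le_norm : ‖(r : ℂ) * z‖ ≤ ‖z‖ := by
  rw [norm_dilate_eq]
  exact mul_le_of_le_one_left (norm_nonneg _) r.2.2.le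

theorem norm_dilate_le_radius (hz : z ∈ disc) : ‖(r : ℂ) * z‖ ≤ r := by
  rw [norm_dilate_eq]
  exact mul_le_of_le_one_right r.2.1 (mem_disc.mp hz).le

theorem dilate_mem_disc (hz : z ∈ disc) : (r : ℂ) * z ∈ disc :=
  mem_disc.mpr ((norm_dilate_le_norm r).trans_lt (mem_disc.mp hz))

namespace Hinf

theorem weight_mul_norm_dilate_le (f : Hinf ν) (hz : z ∈ disc) : ν z * ‖f (r * z)‖ ≤ ‖f‖ :=
  (mul_le_mul_of_nonneg_right (ν.le_of_norm_le hz (norm_dilate_le_norm r)) (norm_nonneg _)).trans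
    (f.le_norm (dilate_mem_disc r hz))

/-- The dilated function `z ↦ f(r z)` as an element of `H^∞_ν`. -/
def dilate (f : Hinf ν) : Hinf ν :=
  ofBound (fun z => f (r * z))
    (f.differentiableOn.comp ((differentiableOn_const _).mul differentiableOn_id)
      fun _ => dilate_mem_disc r)
    ‖f‖ fun _ => f.weight_mul_norm_dilate_le r

theorem dilate_apply (f : Hinf ν) (hz : z ∈ disc) : f.dilate r z = f (r * z) :=
  ofBound_apply _ _ hz

theorem dilate_mem_H0 (f : Hinf ν) : f.dilate r ∈ H0 ν :=
  ν.vanishesAtBoundary_of_norm_le (B := ‖f‖ / ν (r : ℝ)) fun z hz => by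
    rw [f.dilate_apply r hz]
    exact f.norm_apply_le r.2.2 (norm_dilate_le_radius r hz)

/-- The dilation operator `f ↦ f(r ·)`, which maps `H^∞_ν` into `H^0_ν`. -/
def dilation (ν : NormalWeight) : Hinf ν →L[ℂ] H0 ν :=
  LinearMap.mkContinuous
    { toFun := fun f => ⟨f.dilate r, f.dilate_mem_H0 r⟩
      map_add' := fun f g => Subtype.ext (ext fun z hz => by
        simp only [Submodule.coe_add, add_apply, dilate_apply r _ hz])
      map_smul' := fun c f => Subtype.ext (ext fun z hz => by
        simp only [Submodule.coe_smul, smul_apply, dilate_apply r _ hz, RingHom.id_apply]) }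
    1 fun f => by
      rw [one_mul]
      refine H0.norm_le fun z hz => ?_
      exact (congrArg (ν z * ‖·‖) (f.dilate_apply r hz)).trans_le
        (f.weight_mul_norm_dilate_le r hz)

theorem dilation_apply (f : Hinf ν) (hz : z ∈ disc) : (dilation r ν f : Hinf ν) z = f (r * z) :=
  f.dilate_apply r hz

theorem norm_dilation_le (f : Hinf ν) : ‖dilation r ν f‖ ≤ ‖f‖ :=
  H0.norm_le fun z hz => by
    rw [dilation_apply r f hz]
    exact f.weight_mul_norm_dilate_le r hz

end Hinf

/-- The dilation operator as an endomorphism of `H^0_ν`. -/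
def H0.dilation (ν : NormalWeight) : H0 ν →L[ℂ] H0 ν :=
  (Hinf.dilation r ν).comp (H0 ν).subtypeL

theorem H0.dilation_apply (f : H0 ν) : H0.dilation r ν f = Hinf.dilation r ν (f : Hinf ν) := rfl

end Dilation

section Taylor

theorem hasFPowerSeriesOnBall_of_forall_hasSum {c : ℕ → ℂ} {f : ℂ → ℂ}
    (h : ∀ z ∈ disc, HasSum (fun k => z ^ k * c k) (f z)) :
    HasFPowerSeriesOnBall f (FormalMultilinearSeries.ofScalars ℂ c) 0 1 where
  r_le := by
    refine ENNReal.le_of_forall_nnreal_lt fun r hr => ?_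
    have hr' : (r : ℝ) < 1 := by exact_mod_cast hr
    refine FormalMultilinearSeries.le_radius_of_tendsto _ (l := 0) ?_
    have hterm := (h _ (ofReal_mem_disc r.2 hr')).summable.tendsto_atTop_zero.norm
    simpa [FormalMultilinearSeries.ofScalars_norm, mul_comm] using hterm
  r_pos := one_pos
  hasSum := fun {z} hz => by
    have hz' : z ∈ disc := by
      rw [disc, ← Metric.eball_ofReal, ENNReal.ofReal_one]
      exact hz
    simpa [FormalMultilinearSeries.ofScalars_apply_eq, mul_comm] using h z hz'

theorem differentiableOn_of_forall_hasSum {c : ℕ → ℂ} {f : ℂ → ℂ}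
    (h : ∀ z ∈ disc, HasSum (fun k => z ^ k * c k) (f z)) : DifferentiableOn ℂ f disc := by
  have hd := (hasFPowerSeriesOnBall_of_forall_hasSum h).differentiableOn
  rwa [← ENNReal.ofReal_one, Metric.eball_ofReal] at hd

theorem eq_of_forall_hasSum {c d : ℕ → ℂ} {f : ℂ → ℂ}
    (hc : ∀ z ∈ disc, HasSum (fun k => z ^ k * c k) (f z))
    (hd : ∀ z ∈ disc, HasSum (fun k => z ^ k * d k) (f z)) : c = d :=
  FormalMultilinearSeries.ofScalars_series_injective ℂ ℂ
    ((hasFPowerSeriesOnBall_of_forall_hasSum hc).hasFPowerSeriesAt.eq_formalMultilinearSeries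
      (hasFPowerSeriesOnBall_of_forall_hasSum hd).hasFPowerSeriesAt)

theorem hasSum_of_summable_norm_of_forall_apply {E F : Type*} [NormedAddCommGroup E]
    [NormedSpace ℂ E] [NormedAddCommGroup F] [NormedSpace ℂ F] [CompleteSpace F]
    {A : ℕ → E →L[ℂ] F} {B : E →L[ℂ] F} (hA : Summable fun k => ‖A k‖)
    (hAB : ∀ x, HasSum (fun k => A k x) (B x)) : HasSum A B := by
  have h := hA.of_norm.hasSum
  have hB : ∑' k, A k = B := ContinuousLinearMap.ext fun x =>
    (h.mapL ((ContinuousLinearMap.apply ℂ F) x)).unique (hAB x)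
  rwa [hB] at h

variable {ν : NormalWeight}

namespace Hinf

theorem contDiffAt_zero (f : Hinf ν) (n : ℕ) : ContDiffAt ℂ n f 0 :=
  (f.differentiableOn.analyticAt (isOpen_ball.mem_nhds (by simp))).contDiffAt

theorem norm_taylorCoeff_le (f : Hinf ν) (k : ℕ) {ρ : ℝ} (h0 : 0 < ρ) (h1 : ρ < 1) :
    ‖((k.factorial : ℂ))⁻¹ * iteratedDeriv k f 0‖ ≤ (ν ρ)⁻¹ * (ρ ^ k)⁻¹ * ‖f‖ := by
  have hd : DiffContOnCl ℂ f (ball 0 ρ) :=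
    (f.differentiableOn.mono (closedBall_subset_ball h1)).diffContOnCl_ball subset_rfl
  have hCauchy := Complex.norm_iteratedDeriv_le_of_forall_mem_sphere_norm_le k h0 hd
    (C := ‖f‖ / ν ρ) fun z hz => f.norm_apply_le h1 (by simpa using hz.le)
  rw [norm_mul, norm_inv, Complex.norm_natCast,
    inv_mul_le_iff₀ (by exact_mod_cast k.factorial_pos)]
  exact hCauchy.trans_eq (by ring)

/-- The `k`-th Taylor coefficient at the origin, as a bounded functional on `H^∞_ν`. -/
def coeff (ν : NormalWeight) (k : ℕ) : StrongDual ℂ (Hinf ν) :=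
  LinearMap.mkContinuous
    { toFun := fun f => ((k.factorial : ℂ))⁻¹ * iteratedDeriv k f 0
      map_add' := fun f g => by
        rw [← mul_add, ← iteratedDeriv_add (f.contDiffAt_zero k) (g.contDiffAt_zero k)]
        rfl
      map_smul' := fun c f => by
        rw [RingHom.id_apply, smul_eq_mul, mul_left_comm, ← smul_eq_mul c,
          ← iteratedDeriv_const_smul (f.contDiffAt_zero k) c]
        rfl }
    _ fun f => f.norm_taylorCoeff_le k (ρ := 1 / 2) (by norm_num) (by norm_num)

theorem norm_coeff_le (k : ℕ) {ρ : ℝ} (h0 : 0 < ρ) (h1 : ρ < 1) :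
    ‖coeff ν k‖ ≤ (ν ρ)⁻¹ * (ρ ^ k)⁻¹ :=
  ContinuousLinearMap.opNorm_le_bound _
    (mul_nonneg (inv_nonneg.mpr (ν.pos_ofReal h0.le h1).le) (by positivity))
    fun f => f.norm_taylorCoeff_le k h0 h1

theorem summable_pow_mul_norm_coeff {r : ℝ} (h0 : 0 ≤ r) (h1 : r < 1) :
    Summable fun k => r ^ k * ‖coeff ν k‖ := by
  obtain ⟨ρ, hr, hρ⟩ := exists_between h1
  have hρ0 : 0 < ρ := h0.trans_lt hr
  refine Summable.of_nonneg_of_le (fun k => by positivity) (fun k => ?_)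
    ((summable_geometric_of_lt_one (div_nonneg h0 hρ0.le)
      ((div_lt_one hρ0).mpr hr)).mul_left (ν ρ)⁻¹)
  calc r ^ k * ‖coeff ν k‖ ≤ r ^ k * ((ν ρ)⁻¹ * (ρ ^ k)⁻¹) :=
        mul_le_mul_of_nonneg_left (norm_coeff_le k hρ0 hρ) (by positivity)
    _ = (ν ρ)⁻¹ * (r / ρ) ^ k := by rw [div_pow]; ring

theorem hasSum_coeff (f : Hinf ν) {z : ℂ} (hz : z ∈ disc) :
    HasSum (fun k => z ^ k * coeff ν k f) (f z) := by
  refine (Complex.hasSum_taylorSeries_on_ball f.differentiableOn hz).congr_fun fun k => ?_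
  simp only [sub_zero, smul_eq_mul]
  exact mul_left_comm _ _ _

theorem tendsto_of_tendstoUniformlyOn {ι : Type*} {p : Filter ι} {F : ι → Hinf ν} {f : Hinf ν}
    (h : TendstoUniformlyOn (fun i z => F i z) f p disc) : Tendsto F p (𝓝 f) := by
  rw [tendsto_iff_norm_sub_tendsto_zero, Metric.tendsto_nhds]
  intro ε hε
  have h0 := ν.pos 0 (mem_ball_self one_pos)
  filter_upwards [Metric.tendstoUniformlyOn_iff.mp h (ε / 2 / ν 0) (by positivity)] with i hi
  rw [dist_zero_right, norm_norm]
  refine (Hinf.norm_le fun z hz => ?_).trans_lt (half_lt_self hε)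
  have hle := (hi z hz).le
  rw [dist_comm, dist_eq_norm, ← sub_apply] at hle
  calc ν z * ‖(F i - f) z‖ ≤ ν 0 * (ε / 2 / ν 0) :=
        mul_le_mul (ν.le_of_norm_le hz (by simp)) hle (norm_nonneg _) h0.le
    _ = ε / 2 := mul_div_cancel₀ _ h0.ne'

end Hinf

/-- The `k`-th Taylor coefficient at the origin, as a bounded functional on `H^0_ν`. -/
def H0.coeff (ν : NormalWeight) (k : ℕ) : StrongDual ℂ (H0 ν) :=
  (Hinf.coeff ν k).comp (H0 ν).subtypeL

theorem H0.norm_coeff_le (k : ℕ) : ‖H0.coeff ν k‖ ≤ ‖Hinf.coeff ν k‖ :=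
  ContinuousLinearMap.opNorm_le_bound _ (norm_nonneg _) fun f => (Hinf.coeff ν k).le_opNorm f

theorem hasSum_pointEval (z : disc) :
    HasSum (fun k => (z : ℂ) ^ k • H0.coeff ν k) (pointEval ν z) := by
  refine hasSum_of_summable_norm_of_forall_apply ?_ fun f => (f : Hinf ν).hasSum_coeff z.2
  refine (Hinf.summable_pow_mul_norm_coeff (ν := ν) (norm_nonneg (z : ℂ))
    (mem_disc.mp z.2)).of_nonneg_of_le (fun _ => norm_nonneg _) fun k => ?_
  rw [norm_smul, norm_pow]
  exact mul_le_mul_of_nonneg_left (H0.norm_coeff_le k) (by positivity)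

end Taylor

section Monomial

variable {ν : NormalWeight}

theorem norm_pow_le_one_of_mem_disc {z : ℂ} (hz : z ∈ disc) (k : ℕ) : ‖z ^ k‖ ≤ 1 := by
  rw [norm_pow]
  exact pow_le_one₀ (norm_nonneg _) (mem_disc.mp hz).le

theorem NormalWeight.mul_norm_pow_le (ν : NormalWeight) (k : ℕ) {z : ℂ} (hz : z ∈ disc) :
    ν z * ‖z ^ k‖ ≤ ν 0 :=
  (mul_le_of_le_one_right (ν.pos z hz).le (norm_pow_le_one_of_mem_disc hz k)).trans
    (ν.le_of_norm_le hz (by simp))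

/-- The monomial `z ^ k` as an element of `H^0_ν`. -/
def monomial (ν : NormalWeight) (k : ℕ) : H0 ν :=
  ⟨Hinf.ofBound (fun z => z ^ k) (differentiableOn_pow k) (ν 0) fun _ => ν.mul_norm_pow_le k,
    (ν.vanishesAtBoundary_of_norm_le fun _ hz => norm_pow_le_one_of_mem_disc hz k).congr
      fun _ hz => (Hinf.ofBound_apply _ _ hz).symm⟩

theorem monomial_apply (k : ℕ) {z : ℂ} (hz : z ∈ disc) : (monomial ν k : Hinf ν) z = z ^ k :=
  Hinf.ofBound_apply (differentiableOn_pow k) (fun _ => ν.mul_norm_pow_le k) hz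

theorem norm_monomial_le (k : ℕ) : ‖monomial ν k‖ ≤ ν 0 :=
  H0.norm_le fun z hz => by
    rw [monomial_apply k hz]
    exact ν.mul_norm_pow_le k hz

variable (r : Ico (0 : ℝ) 1)

theorem hasSum_dilation (f : Hinf ν) :
    HasSum (fun k => ((r : ℂ) ^ k * Hinf.coeff ν k f) • monomial ν k) (Hinf.dilation r ν f) := by
  have hsummable : Summable fun k => ‖(r : ℂ) ^ k * Hinf.coeff ν k f‖ :=
    (f.hasSum_coeff (ofReal_mem_disc r.2.1 r.2.2)).summable.norm
  refine tendsto_subtype_rng.mpr (Hinf.tendsto_of_tendstoUniformlyOn ?_)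
  refine ((tendstoUniformlyOn_tsum (s := disc)
    (f := fun k z => ((r : ℂ) ^ k * Hinf.coeff ν k f) * z ^ k) hsummable fun k z hz => ?_).congr
    (Eventually.of_forall fun s z hz => ?_)).congr_right fun z hz => ?_
  · rw [norm_mul]
    exact mul_le_of_le_one_right (norm_nonneg _) (norm_pow_le_one_of_mem_disc hz k)
  · simp only [Submodule.coe_sum, Submodule.coe_smul, Hinf.sum_apply, Hinf.smul_apply,
      monomial_apply _ hz]
  · simp only [Hinf.dilation_apply r f hz]
    refine ((f.hasSum_coeff (dilate_mem_disc r hz)).congr_fun fun k => ?_).tsum_eq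
    ring

variable {F : Type*} [NormedAddCommGroup F] [NormedSpace ℂ F] [CompleteSpace F]

theorem hasSum_comp_dilation (T : H0 ν →L[ℂ] F) :
    HasSum (fun k => (r : ℂ) ^ k • (Hinf.coeff ν k).smulRight (T (monomial ν k)))
      (T.comp (Hinf.dilation r ν)) := by
  refine hasSum_of_summable_norm_of_forall_apply ?_ fun f => ?_
  · refine ((Hinf.summable_pow_mul_norm_coeff (ν := ν) r.2.1 r.2.2).mul_right
      (‖T‖ * ν 0)).of_nonneg_of_le (fun _ => norm_nonneg _) fun k => ?_
    rw [norm_smul, norm_pow, Complex.norm_real, Real.norm_of_nonneg r.2.1,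
      ContinuousLinearMap.norm_smulRight_apply, ← mul_assoc]
    refine mul_le_mul_of_nonneg_left ?_ (mul_nonneg (pow_nonneg r.2.1 k) (norm_nonneg _))
    exact (T.le_opNorm _).trans (mul_le_mul_of_nonneg_left (norm_monomial_le k) (norm_nonneg _))
  · refine ((hasSum_dilation r f).mapL T).congr_fun fun k => ?_
    simp [mul_smul]

theorem isCompactOperator_comp_dilation (T : H0 ν →L[ℂ] F) :
    IsCompactOperator (T.comp (Hinf.dilation r ν)) := by
  refine isCompactOperator_of_tendsto (hasSum_comp_dilation r T) (Eventually.of_forall fun s => ?_)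
  refine Submodule.sum_mem (compactOperator (RingHom.id ℂ) (Hinf ν) F) fun k _ =>
    Submodule.smul_mem _ _ ?_
  exact (isCompactOperator_of_locallyCompactSpace_dom (Hinf.coeff ν k)).clm_comp
    ((ContinuousLinearMap.id ℂ ℂ).smulRight (T (monomial ν k)))

end Monomial

section LocallyUniform

variable {ν : NormalWeight}

theorem tendstoLocallyUniformlyOn_disc_iff {ι : Type*} {p : Filter ι} {F : ι → ℂ → ℂ} {f : ℂ → ℂ} :
    TendstoLocallyUniformlyOn F f p disc ↔
      ∀ R < 1, TendstoUniformlyOn F f p (closedBall 0 R) := by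
  rw [tendstoLocallyUniformlyOn_iff_forall_isCompact isOpen_ball]
  refine ⟨fun h R hR => h _ (closedBall_subset_ball hR) (isCompact_closedBall 0 R),
    fun h K hK hKc => ?_⟩
  obtain ⟨R, hR, hKR⟩ := exists_lt_subset_ball hKc.isClosed hK
  exact (h R hR).mono (hKR.trans ball_subset_closedBall)

theorem Hinf.exists_norm_deriv_le (ν : NormalWeight) {R : ℝ} (hR : R < 1) :
    ∃ C, ∀ (f : Hinf ν) (z : ℂ), ‖z‖ ≤ R → ‖deriv f z‖ ≤ C * ‖f‖ := by
  refine ⟨(ν ((1 + R) / 2 : ℝ))⁻¹ / ((1 - R) / 2), fun f z hz => ?_⟩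
  have hsub : closedBall z ((1 - R) / 2) ⊆ closedBall 0 ((1 + R) / 2) :=
    closedBall_subset_closedBall' (by rw [dist_zero_right]; linarith)
  have hd : DiffContOnCl ℂ f (ball z ((1 - R) / 2)) :=
    (f.differentiableOn.mono (hsub.trans (closedBall_subset_ball
      (by linarith)))).diffContOnCl_ball subset_rfl
  refine (Complex.norm_deriv_le_of_forall_mem_sphere_norm_le (C := ‖f‖ / ν ((1 + R) / 2 : ℝ))
    (by linarith) hd fun w hw => ?_).trans_eq (by ring)
  exact f.norm_apply_le (by linarith) (by simpa using hsub (sphere_subset_closedBall hw))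

theorem Hinf.exists_norm_sub_dilate_le (ν : NormalWeight) {R : ℝ} (hR : R < 1) :
    ∃ C, ∀ (f : Hinf ν) (r : Ico (0 : ℝ) 1) (z : ℂ), ‖z‖ ≤ R →
      ‖f z - f (r * z)‖ ≤ C * ‖f‖ * (1 - r) := by
  obtain ⟨C, hC⟩ := exists_norm_deriv_le ν hR
  refine ⟨C, fun f r z hz => ?_⟩
  have hCf : 0 ≤ C * ‖f‖ := (norm_nonneg _).trans (hC f z hz)
  have hr : 0 ≤ 1 - (r : ℝ) := sub_nonneg.mpr r.2.2.le
  have hmv := Convex.norm_image_sub_le_of_norm_deriv_le (𝕜 := ℂ) (f := f)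
    (fun w hw => f.differentiableOn.differentiableAt
      (isOpen_ball.mem_nhds (closedBall_subset_ball hR hw)))
    (fun w hw => hC f w (by simpa using hw)) (convex_closedBall 0 R)
    (x := (r : ℂ) * z) (y := z)
    (by simpa using (norm_dilate_le_norm r).trans hz) (by simpa using hz)
  refine hmv.trans (mul_le_mul_of_nonneg_left ?_ hCf)
  calc ‖z - (r : ℂ) * z‖ = (1 - r) * ‖z‖ := by
        rw [← one_sub_mul, norm_mul, ← Complex.ofReal_one, ← Complex.ofReal_sub,
          Complex.norm_real, Real.norm_of_nonneg hr]
    _ ≤ 1 - r := mul_le_of_le_one_right hr (hz.trans hR.le)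

/-- The radii `1 - 1/(n+2)`, a fixed sequence increasing to `1`. -/
def radius (n : ℕ) : Ico (0 : ℝ) 1 :=
  ⟨1 - 1 / ((n : ℝ) + 2), by
    have h : (0 : ℝ) < n + 2 := by positivity
    constructor
    · rw [sub_nonneg, div_le_one h]
      linarith [n.cast_nonneg (α := ℝ)]
    · linarith [one_div_pos.mpr h]⟩

theorem tendsto_radius : Tendsto (fun n => (radius n : ℝ)) atTop (𝓝 1) := by
  have h : Tendsto (fun n : ℕ => (1 : ℝ) / (n + 2)) atTop (𝓝 0) :=
    tendsto_const_nhds.div_atTop (tendsto_atTop_add_const_right _ _ tendsto_natCast_atTop_atTop)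
  simpa [radius] using h.const_sub 1

theorem tendstoLocallyUniformlyOn_sub_dilation {f : ℕ → Hinf ν} {M : ℝ} (hM : ∀ n, ‖f n‖ ≤ M) :
    TendstoLocallyUniformlyOn (fun n z => (f n - Hinf.dilation (radius n) ν (f n) : Hinf ν) z) 0
      atTop disc := by
  refine tendstoLocallyUniformlyOn_disc_iff.mpr fun R hR => ?_
  obtain ⟨C, hC⟩ := Hinf.exists_norm_sub_dilate_le ν hR
  have hlim : Tendsto (fun n => |C| * M * (1 - radius n)) atTop (𝓝 0) := by
    simpa using (tendsto_radius.const_sub 1).const_mul (|C| * M)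
  refine Metric.tendstoUniformlyOn_iff.mpr fun ε hε => ?_
  filter_upwards [hlim.eventually_lt_const hε] with n hn z hz
  have hz' : ‖z‖ ≤ R := by simpa using hz
  rw [Pi.zero_apply, dist_zero_left, Hinf.sub_apply,
    Hinf.dilation_apply _ _ (mem_disc.mpr (hz'.trans_lt hR))]
  refine ((hC (f n) (radius n) z hz').trans ?_).trans_lt hn
  have hr : 0 ≤ 1 - (radius n : ℝ) := sub_nonneg.mpr (radius n).2.2.le
  exact mul_le_mul_of_nonneg_right
    (mul_le_mul (le_abs_self C) (hM n) (norm_nonneg _) (abs_nonneg C)) hr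

theorem tendstoLocallyUniformlyOn_dilation (f : Hinf ν) :
    TendstoLocallyUniformlyOn (fun n z => (Hinf.dilation (radius n) ν f : Hinf ν) z) f atTop
      disc := by
  have hsub := tendstoLocallyUniformlyOn_sub_dilation (f := fun _ => f) fun _ => le_rfl
  rw [Metric.tendstoLocallyUniformlyOn_iff] at hsub ⊢
  simpa only [Pi.zero_apply, dist_zero_left, Hinf.sub_apply, ← dist_eq_norm] using hsub

end LocallyUniform

section GlidingHump

variable {ν : NormalWeight}

theorem sum_le_add_two_of_forall_or {b : ℕ → ℝ} {M : ℝ} (hM : 0 ≤ M) (hb : ∀ k, b k ≤ M)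
    (hor : ∀ i j, i < j → b i ≤ (1 / 2) ^ i ∨ b j ≤ (1 / 2) ^ j) (s : Finset ℕ) :
    ∑ k ∈ s, b k ≤ M + 2 := by
  have hgeo : ∑ k ∈ s, (1 / 2 : ℝ) ^ k ≤ 2 :=
    sum_le_hasSum s (fun k _ => by positivity) hasSum_geometric_two
  by_cases h : ∃ i, (1 / 2) ^ i < b i
  · obtain ⟨i, hi⟩ := h
    have hle : ∀ k, b k ≤ (if k = i then M else 0) + (1 / 2) ^ k := fun k => by
      split_ifs with hk
      · exact (hb k).trans (by simp)
      · rw [zero_add]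
        rcases lt_or_gt_of_ne hk with hk | hk
        · exact (hor k i hk).resolve_right (not_le.mpr hi)
        · exact (hor i k hk).resolve_left (not_le.mpr hi)
    refine (Finset.sum_le_sum fun k _ => hle k).trans ?_
    rw [Finset.sum_add_distrib, Finset.sum_ite_eq']
    refine add_le_add ?_ hgeo
    split_ifs
    · exact le_rfl
    · exact hM
  · push Not at h
    linarith [Finset.sum_le_sum fun k (_ : k ∈ s) => h k]

/-- Each hump is small near the boundary, and locally uniformly null humps taken far enough along
are small on the remaining disc. -/
theorem exists_forall_lt_or_le {f : ℕ → H0 ν}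
    (hf : TendstoLocallyUniformlyOn (fun n z => (f n : Hinf ν) z) 0 atTop disc) :
    ∃ τ : ℕ → ℕ, ∀ i j, i < j → ∀ z ∈ disc, ν z * ‖(f (τ i) : Hinf ν) z‖ ≤ (1 / 2) ^ i ∨
      ν z * ‖(f (τ j) : Hinf ν) z‖ ≤ (1 / 2) ^ j := by
  have h0 := ν.pos 0 (mem_ball_self one_pos)
  -- The first component of a pair is the exponent in the tolerance, the second one the index.
  obtain ⟨p, -, hp⟩ := exists_seq_of_forall_finset_exists (α := ℕ × ℕ) (fun _ => True)
    (fun p q => p.1 < q.1 ∧ ∀ z ∈ disc, ν z * ‖(f p.2 : Hinf ν) z‖ ≤ (1 / 2) ^ p.1 ∨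
      ν z * ‖(f q.2 : Hinf ν) z‖ ≤ (1 / 2) ^ q.1) (fun s _ => by
    let k := s.sup Prod.fst + 1
    have hboundary : ∀ p : ℕ × ℕ, ∃ R : ℝ, 0 ≤ R ∧ R < 1 ∧
        ∀ z ∈ disc, R < ‖z‖ → ν z * ‖(f p.2 : Hinf ν) z‖ < (1 / 2) ^ p.1 := fun p =>
      (vanishesAtBoundary_iff fun z hz => (ν.pos z hz).le).mp (f p.2).2 _ (by positivity)
    choose R _ hR1 hR using hboundary
    have hinner : ∀ᶠ n in atTop, ∀ p ∈ s, ∀ z ∈ closedBall (0 : ℂ) (R p),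
        dist 0 ((f n : Hinf ν) z) < (1 / 2) ^ k / ν 0 :=
      (Filter.eventually_all_finset s).mpr fun p _ => Metric.tendstoUniformlyOn_iff.mp
        (tendstoLocallyUniformlyOn_disc_iff.mp hf (R p) (hR1 p)) _ (by positivity)
    obtain ⟨n, hn⟩ := hinner.exists
    refine ⟨(k, n), trivial, fun p hp => ⟨Nat.lt_succ_of_le (Finset.le_sup (f := Prod.fst) hp),
      fun z hz => (lt_or_ge (R p) ‖z‖).imp (fun h => (hR p z hz h).le) fun h => ?_⟩⟩
    have hsmall := hn p hp z (by simpa using h)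
    rw [dist_zero_left, lt_div_iff₀ h0, mul_comm] at hsmall
    exact (mul_le_mul_of_nonneg_right (ν.le_of_norm_le hz (by simp))
      (norm_nonneg _)).trans hsmall.le)
  have hmono : StrictMono fun k => (p k).1 := fun i j hij => (hp i j hij).1
  have hpow : ∀ k, (1 / 2 : ℝ) ^ (p k).1 ≤ (1 / 2) ^ k := fun k =>
    pow_le_pow_of_le_one (by norm_num) (by norm_num) hmono.le_apply
  exact ⟨fun k => (p k).2, fun i j hij z hz => ((hp i j hij).2 z hz).imp
    (fun h => h.trans (hpow i)) fun h => h.trans (hpow j)⟩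

theorem exists_isWeaklyUnconditionallyBounded_comp {f : ℕ → H0 ν}
    (hf : TendstoLocallyUniformlyOn (fun n z => (f n : Hinf ν) z) 0 atTop disc) {M : ℝ}
    (hM : ∀ n, ‖f n‖ ≤ M) : ∃ τ : ℕ → ℕ, IsWeaklyUnconditionallyBounded (f ∘ τ) (M + 2) := by
  obtain ⟨τ, hτ⟩ := exists_forall_lt_or_le hf
  refine ⟨τ, fun s c hc => H0.norm_le fun z hz => ?_⟩
  have hsum : ∑ k ∈ s, ν z * ‖(f (τ k) : Hinf ν) z‖ ≤ M + 2 :=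
    sum_le_add_two_of_forall_or ((norm_nonneg _).trans (hM 0))
      (fun k => ((f (τ k) : Hinf ν).le_norm hz).trans (hM _)) (fun i j hij => hτ i j hij z hz) s
  rw [Submodule.coe_sum, Hinf.sum_apply]
  refine le_trans ?_ hsum
  rw [← Finset.mul_sum]
  refine mul_le_mul_of_nonneg_left ((norm_sum_le _ _).trans (Finset.sum_le_sum fun k _ => ?_))
    (ν.pos z hz).le
  rw [Submodule.coe_smul, Hinf.smul_apply, norm_mul]
  exact mul_le_of_le_one_left (norm_nonneg _) (hc k)

variable {F : Type*} [NormedAddCommGroup F] [NormedSpace ℂ F] {T : H0 ν →L[ℂ] F}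

theorem IsWeaklyCompactOperator.tendsto_apply (hT : IsWeaklyCompactOperator T) {f : ℕ → H0 ν}
    (hf : TendstoLocallyUniformlyOn (fun n z => (f n : Hinf ν) z) 0 atTop disc) {M : ℝ}
    (hM : ∀ n, ‖f n‖ ≤ M) : Tendsto (fun n => T (f n)) atTop (𝓝 0) := by
  refine tendsto_of_subseq_tendsto fun σ hσ => ?_
  have hfσ : TendstoLocallyUniformlyOn (fun n z => (f (σ n) : Hinf ν) z) 0 atTop disc :=
    fun u hu z hz => (hf u hu z hz).imp fun _ => And.imp_right fun h => hσ.eventually h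
  obtain ⟨τ, hτ⟩ := exists_isWeaklyUnconditionallyBounded_comp hfσ fun n => hM (σ n)
  exact ⟨τ, hτ.tendsto_apply hT⟩

theorem tendsto_zero_of_forall_tendsto_apply {E F : Type*} [NormedAddCommGroup E]
    [NormedSpace ℂ E] [NormedAddCommGroup F] [NormedSpace ℂ F] {A : ℕ → E →L[ℂ] F}
    (h : ∀ x : ℕ → E, (∀ n, ‖x n‖ ≤ 1) → Tendsto (fun n => A n (x n)) atTop (𝓝 0)) :
    Tendsto A atTop (𝓝 0) := by
  have hnorming : ∀ n, ∃ x, ‖x‖ ≤ 1 ∧ ‖A n‖ ≤ 2 * ‖A n x‖ := fun n => by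
    rcases (norm_nonneg (A n)).eq_or_lt with hA | hA
    · exact ⟨0, by simp, by simp [← hA]⟩
    · obtain ⟨x, hx, hAx⟩ := (A n).exists_lt_apply_of_lt_opNorm (half_lt_self hA)
      exact ⟨x, hx.le, by linarith⟩
  choose x hx hAx using hnorming
  exact squeeze_zero_norm hAx (by simpa using (h x hx).norm.const_mul 2)

theorem IsWeaklyCompactOperator.tendsto_comp_dilation (hT : IsWeaklyCompactOperator T) :
    Tendsto (fun n => T.comp (H0.dilation (radius n) ν)) atTop (𝓝 T) := by
  refine tendsto_sub_nhds_zero_iff.mp (tendsto_zero_of_forall_tendsto_apply fun f hf => ?_)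
  have hbound : ∀ n, ‖f n - H0.dilation (radius n) ν (f n)‖ ≤ 2 := fun n => by
    have hD : ‖H0.dilation (radius n) ν (f n)‖ ≤ ‖f n‖ :=
      Hinf.norm_dilation_le (radius n) (f n : Hinf ν)
    linarith [norm_sub_le (f n) (H0.dilation (radius n) ν (f n)), hf n]
  have hlim := hT.tendsto_apply (tendstoLocallyUniformlyOn_sub_dilation hf) hbound
  simpa [neg_sub] using hlim.neg

theorem IsWeaklyCompactOperator.isCompactOperator [CompleteSpace F]
    (hT : IsWeaklyCompactOperator T) : IsCompactOperator T :=
  isCompactOperator_of_tendsto hT.tendsto_comp_dilation (Eventually.of_forall fun n =>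
    (isCompactOperator_comp_dilation (radius n) T).comp_clm (H0 ν).subtypeL)

theorem tendsto_functional_comp_dilation (l : StrongDual ℂ (H0 ν)) :
    Tendsto (fun n => l.comp (H0.dilation (radius n) ν)) atTop (𝓝 l) :=
  (isWeaklyCompactOperator_of_isCompactOperator
    (isCompactOperator_of_locallyCompactSpace_dom l)).tendsto_comp_dilation

/-- Density of the polynomials in `H^0_ν`, in dual form. -/
theorem eq_zero_of_forall_apply_monomial_eq_zero (h : ∀ k, T (monomial ν k) = 0) : T = 0 := by
  refine ContinuousLinearMap.ext fun f =>
    SeparatingDual.eq_zero_of_forall_dual_eq_zero (R := ℂ) fun l => ?_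
  have hzero : ∀ n, (l.comp T).comp (H0.dilation (radius n) ν) f = 0 := fun n =>
    ((hasSum_dilation (radius n) (f : Hinf ν)).mapL (l.comp T)).unique (by simp [h])
  exact tendsto_nhds_unique ((((ContinuousLinearMap.apply ℂ ℂ) f).continuous.tendsto _).comp
    (tendsto_functional_comp_dilation (l.comp T))) (by simp [hzero, Function.comp_def])

end GlidingHump

section Bidual

variable {ν : NormalWeight}

/-- The bidual of `H^0_ν`. -/
abbrev Bidual (ν : NormalWeight) : Type := StrongDual ℂ (StrongDual ℂ (H0 ν))

theorem norm_pointEval_le (z : disc) : ‖pointEval ν z‖ ≤ (ν z)⁻¹ :=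
  LinearMap.mkContinuous_norm_le _ (inv_nonneg.mpr (ν.pos z z.2).le) _

theorem hasSum_bidual_apply_coeff (x : Bidual ν) (z : disc) :
    HasSum (fun k => (z : ℂ) ^ k * x (H0.coeff ν k)) (x (pointEval ν z)) := by
  simpa using (hasSum_pointEval z).mapL x

/-- The function `z ↦ ⟨x, δ_z⟩` on the disc, written as a power series so that its analyticity is
visible and no membership proof `z ∈ disc` is needed to write it down. -/
def bidualSeries (x : Bidual ν) (z : ℂ) : ℂ := ∑' k, z ^ k * x (H0.coeff ν k)

theorem bidualSeries_eq (x : Bidual ν) (z : disc) : bidualSeries x z = x (pointEval ν z) :=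
  (hasSum_bidual_apply_coeff x z).tsum_eq

theorem hasSum_bidualSeries (x : Bidual ν) (z : ℂ) (hz : z ∈ disc) :
    HasSum (fun k => z ^ k * x (H0.coeff ν k)) (bidualSeries x z) :=
  (hasSum_bidual_apply_coeff x ⟨z, hz⟩).summable.hasSum

theorem weight_mul_norm_bidualSeries_le (x : Bidual ν) (z : ℂ) (hz : z ∈ disc) :
    ν z * ‖bidualSeries x z‖ ≤ ‖x‖ := by
  have h := x.le_of_opNorm_le_of_le le_rfl (norm_pointEval_le (ν := ν) ⟨z, hz⟩)
  rwa [← bidualSeries_eq, ← div_eq_mul_inv, le_div_iff₀ (ν.pos z hz), mul_comm] at h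

/-- The restriction of a functional on the dual of `H^0_ν` to the point evaluations. -/
def bidualToHinf (ν : NormalWeight) : Bidual ν →ₗ[ℂ] Hinf ν where
  toFun x := Hinf.ofBound (bidualSeries x) (differentiableOn_of_forall_hasSum
    (hasSum_bidualSeries x)) ‖x‖ (weight_mul_norm_bidualSeries_le x)
  map_add' x y := Hinf.ext fun z hz => by
    simp only [Hinf.add_apply, Hinf.ofBound_apply _ _ hz, bidualSeries_eq _ ⟨z, hz⟩, add_apply]
  map_smul' c x := Hinf.ext fun z hz => by
    simp only [Hinf.smul_apply, Hinf.ofBound_apply _ _ hz, bidualSeries_eq _ ⟨z, hz⟩, smul_apply,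
      RingHom.id_apply, smul_eq_mul]

theorem bidualToHinf_apply (x : Bidual ν) (z : disc) :
    bidualToHinf ν x z = x (pointEval ν z) :=
  (Hinf.ofBound_apply (differentiableOn_of_forall_hasSum (hasSum_bidualSeries x))
    (weight_mul_norm_bidualSeries_le x) z.2).trans (bidualSeries_eq x z)

theorem norm_bidualToHinf_le (x : Bidual ν) : ‖bidualToHinf ν x‖ ≤ ‖x‖ :=
  Hinf.norm_le fun z hz => by
    rw [bidualToHinf_apply x ⟨z, hz⟩, ← bidualSeries_eq]
    exact weight_mul_norm_bidualSeries_le x z hz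

theorem coeff_bidualToHinf (x : Bidual ν) (k : ℕ) :
    Hinf.coeff ν k (bidualToHinf ν x) = x (H0.coeff ν k) :=
  congrFun (eq_of_forall_hasSum (c := fun k => Hinf.coeff ν k (bidualToHinf ν x))
    (fun _ => (bidualToHinf ν x).hasSum_coeff) fun z hz => by
      rw [bidualToHinf_apply x ⟨z, hz⟩]
      exact hasSum_bidual_apply_coeff x ⟨z, hz⟩) k

/-- Both sides have the expansion `∑ r ^ k * x (coeff k) * l (monomial k)`. -/
theorem bidual_apply_comp_dilation (x : Bidual ν) (l : StrongDual ℂ (H0 ν)) (r : Ico (0 : ℝ) 1) :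
    x (l.comp (H0.dilation r ν)) = l (Hinf.dilation r ν (bidualToHinf ν x)) := by
  have hleft := (hasSum_comp_dilation r l).mapL (x.comp (transpose (H0 ν).subtypeL))
  have hright := (hasSum_dilation r (bidualToHinf ν x)).mapL l
  refine hleft.unique (hright.congr_fun fun k => ?_)
  have hrestrict : transpose (H0 ν).subtypeL
      ((Hinf.coeff ν k).smulRight (l (monomial ν k))) = l (monomial ν k) • H0.coeff ν k :=
    ContinuousLinearMap.ext fun f => mul_comm _ _
  simp only [ContinuousLinearMap.comp_apply, map_smul, hrestrict, coeff_bidualToHinf, smul_eq_mul]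
  ring

theorem tendsto_apply_dilation_bidualToHinf (x : Bidual ν) (l : StrongDual ℂ (H0 ν)) :
    Tendsto (fun n => l (Hinf.dilation (radius n) ν (bidualToHinf ν x))) atTop (𝓝 (x l)) :=
  ((x.continuous.tendsto l).comp (tendsto_functional_comp_dilation l)).congr fun n =>
    bidual_apply_comp_dilation x l (radius n)

theorem norm_bidualToHinf (x : Bidual ν) : ‖bidualToHinf ν x‖ = ‖x‖ := by
  refine le_antisymm (norm_bidualToHinf_le x)
    (x.opNorm_le_bound (norm_nonneg _) fun l => ?_)
  refine le_of_tendsto (tendsto_apply_dilation_bidualToHinf x l).norm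
    (Eventually.of_forall fun n => (l.le_opNorm _).trans ?_)
  rw [mul_comm]
  exact mul_le_mul_of_nonneg_right (Hinf.norm_dilation_le _ _) (norm_nonneg l)

theorem bidualToHinf_surjective : Function.Surjective (bidualToHinf ν) := fun f => by
  -- A weak-* cluster point of the dilations of `f` evaluates to `f` at every `δ_z`.
  let u : ℕ → WeakDual ℂ (StrongDual ℂ (H0 ν)) := fun n => StrongDual.toWeakDual
    (NormedSpace.inclusionInDoubleDual ℂ (H0 ν) (Hinf.dilation (radius n) ν f))
  have hu : map u atTop ≤ 𝓟 (WeakDual.toStrongDual ⁻¹' closedBall (0 : Bidual ν) ‖f‖) :=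
    le_principal_iff.mpr <| Filter.mem_map.mpr <| Eventually.of_forall fun n =>
      mem_closedBall_zero_iff.mpr ((NormedSpace.double_dual_bound ℂ (H0 ν) _).trans
        (Hinf.norm_dilation_le _ f))
  obtain ⟨y, -, hy⟩ := (WeakDual.isCompact_closedBall (𝕜 := ℂ) (0 : Bidual ν)
    ‖f‖).exists_mapClusterPt hu
  obtain ⟨U, hU, hlim⟩ := mapClusterPt_iff_ultrafilter.mp hy
  refine ⟨WeakDual.toStrongDual y, Hinf.ext fun z hz => ?_⟩
  rw [bidualToHinf_apply _ ⟨z, hz⟩]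
  exact tendsto_nhds_unique
    (((WeakDual.eval_continuous (pointEval ν ⟨z, hz⟩)).tendsto y).comp hlim)
    (((tendstoLocallyUniformlyOn_dilation f).tendsto_at hz).mono_left hU)

/-- The canonical isometric identification of `H^∞_ν` with the bidual of `H^0_ν`. -/
def canonicalBidual (ν : NormalWeight) : Hinf ν ≃ₗᵢ[ℂ] Bidual ν :=
  (LinearIsometryEquiv.ofSurjective ⟨bidualToHinf ν, norm_bidualToHinf⟩
    bidualToHinf_surjective).symm

theorem bidualToHinf_canonicalBidual (f : Hinf ν) : bidualToHinf ν (canonicalBidual ν f) = f :=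
  (canonicalBidual ν).symm_apply_apply f

theorem canonicalBidual_pointEval (f : Hinf ν) (z : disc) :
    canonicalBidual ν f (pointEval ν z) = f z := by
  rw [← bidualToHinf_apply, bidualToHinf_canonicalBidual]

theorem tendsto_apply_dilation (f : Hinf ν) (l : StrongDual ℂ (H0 ν)) :
    Tendsto (fun n => l (Hinf.dilation (radius n) ν f)) atTop (𝓝 (canonicalBidual ν f l)) := by
  simpa only [bidualToHinf_canonicalBidual] using
    tendsto_apply_dilation_bidualToHinf (canonicalBidual ν f) l

theorem canonicalBidual_coe (f : H0 ν) :
    canonicalBidual ν f = NormedSpace.inclusionInDoubleDual ℂ (H0 ν) f :=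
  (canonicalBidual ν).symm.injective ((bidualToHinf_canonicalBidual (f : Hinf ν)).trans
    (Hinf.ext fun z hz =>
      (bidualToHinf_apply (NormedSpace.inclusionInDoubleDual ℂ (H0 ν) f) ⟨z, hz⟩).symm))

instance : CompleteSpace (Hinf ν) :=
  (canonicalBidual ν).toIsometryEquiv.completeSpace_iff.mpr inferInstance

end Bidual

section Growth

variable {μ : NormalWeight}

theorem norm_le_add_of_norm_deriv_le_rpow {E : Type*} [NormedAddCommGroup E] [NormedSpace ℝ E]
    {u u' : ℝ → E} {a b γ K : ℝ} (hγ : 0 < γ) (hK : 0 ≤ K) (hab : a ≤ b) (hb : b < 1)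
    (hu : ∀ t ∈ Icc a b, HasDerivAt u (u' t) t)
    (hu' : ∀ t ∈ Ico a b, ‖u' t‖ ≤ K * (1 - t) ^ (-γ - 1)) :
    ‖u b‖ ≤ ‖u a‖ + K / γ * (1 - b) ^ (-γ) := by
  have hbarrier : ∀ t < 1, HasDerivAt (fun t : ℝ => ‖u a‖ + K / γ * (1 - t) ^ (-γ))
      (K * (1 - t) ^ (-γ - 1)) t := fun t ht => by
    have hsub : HasDerivAt (fun t : ℝ => 1 - t) (-1) t := (hasDerivAt_id t).const_sub 1
    refine (((hsub.rpow_const (p := -γ) (Or.inl (by linarith))).const_mul (K / γ)).const_add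
      ‖u a‖).congr_deriv ?_
    rw [neg_mul_neg, one_mul, ← mul_assoc, div_mul_cancel₀ _ hγ.ne']
  have hstart : ‖u a‖ ≤ ‖u a‖ + K / γ * (1 - a) ^ (-γ) :=
    le_add_of_nonneg_right (mul_nonneg (by positivity) (Real.rpow_nonneg (by linarith) _))
  exact image_norm_le_of_norm_deriv_right_le_deriv_boundary'
    (fun t ht => (hu t ht).continuousAt.continuousWithinAt)
    (fun t ht => (hu t (Ico_subset_Icc_self ht)).hasDerivWithinAt) hstart
    (fun t ht => (hbarrier t (ht.2.trans_lt hb)).continuousAt.continuousWithinAt)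
    (fun t ht => (hbarrier t (ht.2.trans hb)).hasDerivWithinAt) hu' (right_mem_Icc.mpr hab)

theorem norm_le_add_of_norm_deriv_le_rpow_ray {h : ℂ → ℂ} (hh : DifferentiableOn ℂ h disc)
    {γ K R : ℝ} (hγ : 0 < γ) (hK : 0 ≤ K) (hR : 0 ≤ R) {z : ℂ} (hz : z ∈ disc) (hRz : R ≤ ‖z‖)
    (hh' : ∀ w : ℂ, R ≤ ‖w‖ → ‖w‖ ≤ ‖z‖ → ‖deriv h w‖ ≤ K * (1 - ‖w‖) ^ (-γ - 1)) :
    ∃ w : ℂ, ‖w‖ = R ∧ ‖h z‖ ≤ ‖h w‖ + K / γ * (1 - ‖z‖) ^ (-γ) := by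
  obtain ⟨e, he, hze⟩ : ∃ e : ℂ, ‖e‖ = 1 ∧ ‖z‖ * e = z :=
    ⟨_, Complex.norm_exp_ofReal_mul_I z.arg, Complex.norm_mul_exp_arg_mul_I z⟩
  have hnorm : ∀ t : ℝ, 0 ≤ t → ‖(t : ℂ) * e‖ = t := fun t ht => by
    rw [norm_mul, he, Complex.norm_of_nonneg ht, mul_one]
  have hderiv : ∀ t ∈ Icc R ‖z‖, HasDerivAt (fun t : ℝ => h (t * e)) (deriv h (t * e) * e) t :=
    fun t ht => by
      have hmem : (t : ℂ) * e ∈ disc :=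
        mem_disc.mpr ((hnorm t (hR.trans ht.1)).trans_lt (ht.2.trans_lt (mem_disc.mp hz)))
      have hray : HasDerivAt (fun t : ℝ => (t : ℂ) * e) e t := by
        simpa using (Complex.ofRealCLM.hasDerivAt (x := t)).mul_const e
      exact (hh.differentiableAt (isOpen_ball.mem_nhds hmem)).hasDerivAt.comp t hray
  refine ⟨R * e, hnorm R hR, ?_⟩
  have hbound := norm_le_add_of_norm_deriv_le_rpow hγ hK hRz (mem_disc.mp hz) hderiv
    fun t ht => by
      have ht0 := hnorm t (hR.trans ht.1)
      simpa only [norm_mul (deriv h _), he, mul_one, ht0] using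
        hh' (t * e) (ht.1.trans_eq ht0.symm) (ht0.trans_le ht.2.le)
  rwa [hze] at hbound

theorem NormalWeight.exists_mul_rpow_le (μ : NormalWeight) : ∃ γ C : ℝ, 0 < γ ∧ 0 < C ∧
    ∀ w z : ℂ, z ∈ disc → ‖w‖ ≤ ‖z‖ →
      μ z * (1 - ‖w‖) ^ γ ≤ C * μ w * (1 - ‖z‖) ^ γ := by
  obtain ⟨γ, hγ, C, hC, hμ⟩ := μ.normal_II
  refine ⟨γ, C * 2 ^ γ, hγ, by positivity, fun w z hz hwz => ?_⟩
  have hz1 := mem_disc.mp hz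
  have hw : w ∈ disc := mem_disc.mpr (hwz.trans_lt hz1)
  have hzsq : 0 < 1 - ‖z‖ ^ 2 := by nlinarith [norm_nonneg z]
  have hwsq : 0 < 1 - ‖w‖ ^ 2 := by nlinarith [norm_nonneg w, mem_disc.mp hw]
  have hμz := μ.pos z hz
  have hμw := μ.pos w hw
  have hw_le : (1 - ‖w‖) ^ γ ≤ (1 - ‖w‖ ^ 2) ^ γ :=
    Real.rpow_le_rpow (by linarith) (by nlinarith [norm_nonneg w]) hγ.le
  have hz_le : (1 - ‖z‖ ^ 2) ^ γ ≤ 2 ^ γ * (1 - ‖z‖) ^ γ := by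
    rw [← Real.mul_rpow (by norm_num) (by linarith)]
    exact Real.rpow_le_rpow hzsq.le (by nlinarith) hγ.le
  have hdecr : μ ‖z‖ / (1 - ‖z‖ ^ 2) ^ γ ≤ C * (μ ‖w‖ / (1 - ‖w‖ ^ 2) ^ γ) :=
    hμ ‖w‖ ‖z‖ (norm_nonneg w) hwz hz1
  rw [← μ.radial z hz, ← μ.radial w hw, ← mul_div_assoc,
    div_le_div_iff₀ (Real.rpow_pos_of_pos hzsq _) (Real.rpow_pos_of_pos hwsq _)] at hdecr
  calc μ z * (1 - ‖w‖) ^ γ ≤ μ z * (1 - ‖w‖ ^ 2) ^ γ := by gcongr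
    _ ≤ C * μ w * (1 - ‖z‖ ^ 2) ^ γ := hdecr
    _ ≤ C * μ w * (2 ^ γ * (1 - ‖z‖) ^ γ) := by gcongr
    _ = C * 2 ^ γ * μ w * (1 - ‖z‖) ^ γ := by ring

theorem one_sub_norm_sq_mul_nonneg {z : ℂ} (hz : z ∈ disc) : 0 ≤ (1 - ‖z‖ ^ 2) * μ z :=
  mul_nonneg (by nlinarith [mem_disc.mp hz, norm_nonneg z]) (μ.pos z hz).le

theorem NormalWeight.exists_mul_norm_le_add (μ : NormalWeight) : ∃ A : ℝ, 0 < A ∧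
    ∀ {h : ℂ → ℂ}, DifferentiableOn ℂ h disc → ∀ {R δ : ℝ}, 0 ≤ R → 0 ≤ δ →
      (∀ w ∈ disc, R ≤ ‖w‖ → (1 - ‖w‖ ^ 2) * μ w * ‖deriv h w‖ ≤ δ) →
      ∀ z ∈ disc, R ≤ ‖z‖ → ∃ w : ℂ, ‖w‖ = R ∧ μ z * ‖h z‖ ≤ μ z * ‖h w‖ + A * δ := by
  obtain ⟨γ, C, hγ, hC, hμ⟩ := μ.exists_mul_rpow_le
  refine ⟨C / γ, by positivity, fun {h} hh {R δ} hR hδ hh' z hz hRz => ?_⟩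
  have hμz := μ.pos z hz
  have hz1 : 0 < 1 - ‖z‖ := sub_pos.mpr (mem_disc.mp hz)
  have hderiv : ∀ w : ℂ, R ≤ ‖w‖ → ‖w‖ ≤ ‖z‖ →
      ‖deriv h w‖ ≤ δ * C * (1 - ‖z‖) ^ γ / μ z * (1 - ‖w‖) ^ (-γ - 1) := fun w hRw hwz => by
    have hw1 : 0 < 1 - ‖w‖ := by linarith
    have hw : w ∈ disc := mem_disc.mpr (sub_pos.mp hw1)
    have hμw := μ.pos w hw
    have hδw : (1 - ‖w‖) * μ w * ‖deriv h w‖ ≤ δ := by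
      refine le_trans ?_ (hh' w hw hRw)
      gcongr
      nlinarith [norm_nonneg w]
    rw [← neg_add', Real.rpow_neg hw1.le, Real.rpow_add_one hw1.ne', ← div_eq_mul_inv, div_div,
      le_div_iff₀ (by positivity)]
    calc ‖deriv h w‖ * (μ z * ((1 - ‖w‖) ^ γ * (1 - ‖w‖)))
        = ‖deriv h w‖ * (1 - ‖w‖) * (μ z * (1 - ‖w‖) ^ γ) := by ring
      _ ≤ ‖deriv h w‖ * (1 - ‖w‖) * (C * μ w * (1 - ‖z‖) ^ γ) := by
        gcongr _ * ?_
        exact hμ w z hz hwz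
      _ = (1 - ‖w‖) * μ w * ‖deriv h w‖ * (C * (1 - ‖z‖) ^ γ) := by ring
      _ ≤ δ * (C * (1 - ‖z‖) ^ γ) := by gcongr
      _ = δ * C * (1 - ‖z‖) ^ γ := by ring
  obtain ⟨w, hw, hbound⟩ :=
    norm_le_add_of_norm_deriv_le_rpow_ray hh hγ (by positivity) hR hz hRz hderiv
  refine ⟨w, hw, (mul_le_mul_of_nonneg_left hbound hμz.le).trans_eq ?_⟩
  rw [Real.rpow_neg hz1.le]
  field_simp

theorem NormalWeight.vanishesAtBoundary_of_deriv {h : ℂ → ℂ} (hh : DifferentiableOn ℂ h disc)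
    (hh' : VanishesAtBoundary (fun z => (1 - ‖z‖ ^ 2) * μ z) (deriv h)) :
    VanishesAtBoundary μ h := by
  have hμ : ∀ z ∈ disc, 0 ≤ μ z := fun z hz => (μ.pos z hz).le
  obtain ⟨A, hA, hgrowth⟩ := μ.exists_mul_norm_le_add
  refine (vanishesAtBoundary_iff hμ).mpr fun ε hε => ?_
  obtain ⟨R₀, hR₀, hR₀1, hδ⟩ :=
    (vanishesAtBoundary_iff fun _ => one_sub_norm_sq_mul_nonneg).mp hh' (ε / (2 * A))
      (by positivity)
  obtain ⟨R, hR₀R, hR1⟩ := exists_between hR₀1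
  obtain ⟨B, hB⟩ := (isCompact_closedBall (0 : ℂ) R).exists_bound_of_continuousOn
    (hh.continuousOn.mono (closedBall_subset_ball hR1))
  obtain ⟨R', -, hR'1, hconst⟩ := (vanishesAtBoundary_iff hμ).mp
    (μ.vanishesAtBoundary_of_norm_le (f := fun _ => (B : ℂ)) fun _ _ => le_rfl) (ε / 2)
    (by positivity)
  have hR := hR₀.trans hR₀R.le
  refine ⟨max R R', le_max_of_le_left hR, max_lt hR1 hR'1, fun z hz hzR => ?_⟩
  obtain ⟨hRz, hR'z⟩ := max_lt_iff.mp hzR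
  obtain ⟨w, hw, hbound⟩ := hgrowth hh hR (by positivity)
    (fun w hw hRw => (hδ w hw (hR₀R.trans_le hRw)).le) z hz hRz.le
  have hBw : ‖h w‖ ≤ ‖(B : ℂ)‖ := by
    rw [Complex.norm_real]
    exact (hB w (by simp [hw])).trans (le_abs_self B)
  calc μ z * ‖h z‖ ≤ μ z * ‖h w‖ + A * (ε / (2 * A)) := hbound
    _ ≤ μ z * ‖(B : ℂ)‖ + ε / 2 := by
        gcongr
        · exact hμ z hz
        · exact (by field_simp : A * (ε / (2 * A)) = ε / 2).le
    _ < ε := by linarith [hconst z hz hR'z]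

end Growth

section Closed

variable {μ : NormalWeight}

theorem isClosed_H0 : IsClosed (H0 μ : Set (Hinf μ)) := by
  refine isClosed_of_closure_subset fun f hf => ?_
  have hμ : ∀ z ∈ disc, 0 ≤ μ z := fun z hz => (μ.pos z hz).le
  refine (vanishesAtBoundary_iff hμ).mpr fun ε hε => ?_
  obtain ⟨h, hh, hfh⟩ := Metric.mem_closure_iff.mp hf (ε / 2) (by positivity)
  obtain ⟨R, hR0, hR1, hR⟩ := (vanishesAtBoundary_iff hμ).mp hh (ε / 2) (by positivity)
  refine ⟨R, hR0, hR1, fun z hz hRz => ?_⟩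
  have hsub : μ z * ‖f z - h z‖ < ε / 2 :=
    ((f - h).le_norm hz).trans_lt (by rwa [← dist_eq_norm])
  calc μ z * ‖f z‖ ≤ μ z * (‖f z - h z‖ + ‖h z‖) :=
        mul_le_mul_of_nonneg_left (norm_le_norm_sub_add _ _) (hμ z hz)
    _ < ε := by linarith [hR z hz hRz]

instance : CompleteSpace (H0 μ) := isClosed_H0.completeSpace_coe

end Closed

section Volterra

variable {g φ f : ℂ → ℂ}

theorem differentiableOn_deriv_comp_mul (hg : DifferentiableOn ℂ g disc)
    (hφ : DifferentiableOn ℂ φ disc) (hφ_maps : MapsTo φ disc disc)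
    (hf : DifferentiableOn ℂ f disc) : DifferentiableOn ℂ (fun z => deriv f (φ z) * g z) disc :=
  ((hf.deriv isOpen_ball).comp hφ hφ_maps).mul hg

theorem mapsTo_segment_disc {z : ℂ} (hz : z ∈ disc) :
    MapsTo (fun t : ℝ => (t : ℂ) * z) (uIcc 0 1) disc := fun t ht => by
  rw [uIcc_of_le zero_le_one] at ht
  rw [mem_disc, norm_mul, Complex.norm_of_nonneg ht.1]
  exact (mul_le_of_le_one_left (norm_nonneg _) ht.2).trans_lt (mem_disc.mp hz)

theorem continuousOn_mul_comp_segment {k : ℂ → ℂ} (hk : ContinuousOn k disc) {z : ℂ}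
    (hz : z ∈ disc) : ContinuousOn (fun t : ℝ => z * k (t * z)) (uIcc 0 1) :=
  continuousOn_const.mul (hk.comp (f := fun t : ℝ => (t : ℂ) * z) (by fun_prop)
    (mapsTo_segment_disc hz))

theorem hasDerivAt_volterraS (hg : DifferentiableOn ℂ g disc)
    (hφ : DifferentiableOn ℂ φ disc) (hφ_maps : MapsTo φ disc disc)
    (hf : DifferentiableOn ℂ f disc) {z : ℂ} (hz : z ∈ disc) :
    HasDerivAt (volterraS g φ f) (deriv f (φ z) * g z) z := by
  have hk := differentiableOn_deriv_comp_mul hg hφ hφ_maps hf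
  obtain ⟨P, hP⟩ := hk.isExactOn_ball
  have heq : ∀ w ∈ disc, volterraS g φ f w = P w - P 0 := fun w hw => by
    have hderiv : ∀ t ∈ uIcc (0 : ℝ) 1, HasDerivAt (fun t : ℝ => P (t * w))
        (w * (deriv f (φ (t * w)) * g (t * w))) t := fun t ht => by
      have hseg : HasDerivAt (fun t : ℝ => (t : ℂ) * w) w t := by
        simpa using (Complex.ofRealCLM.hasDerivAt (x := t)).mul_const w
      exact ((hP _ (mapsTo_segment_disc hw ht)).comp t hseg).congr_deriv (mul_comm _ _)
    simpa [volterraS] using intervalIntegral.integral_eq_sub_of_hasDerivAt hderiv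
      (continuousOn_mul_comp_segment hk.continuousOn hw).intervalIntegrable
  refine ((hP z hz).sub_const (P 0)).congr_of_eventuallyEq ?_
  filter_upwards [isOpen_ball.mem_nhds hz] with w hw using heq w hw

theorem differentiableOn_volterraS (hg : DifferentiableOn ℂ g disc)
    (hφ : DifferentiableOn ℂ φ disc) (hφ_maps : MapsTo φ disc disc)
    (hf : DifferentiableOn ℂ f disc) : DifferentiableOn ℂ (volterraS g φ f) disc :=
  fun _ hz => (hasDerivAt_volterraS hg hφ hφ_maps hf hz).differentiableAt.differentiableWithinAt

theorem tendsto_volterraS {ι : Type*} {l : Filter ι} [l.IsCountablyGenerated]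
    (hg : DifferentiableOn ℂ g disc) (hφ : DifferentiableOn ℂ φ disc)
    (hφ_maps : MapsTo φ disc disc) {F : ι → ℂ → ℂ} (hF : ∀ i, DifferentiableOn ℂ (F i) disc)
    (hf : DifferentiableOn ℂ f disc) (hlim : TendstoLocallyUniformlyOn F f l disc) {z : ℂ}
    (hz : z ∈ disc) : Tendsto (fun i => volterraS g φ (F i) z) l (𝓝 (volterraS g φ f z)) := by
  have hconst : ∀ k : ℂ → ℂ, TendstoLocallyUniformlyOn (fun _ : ι => k) k l disc :=
    fun k u hu w _ => ⟨disc, self_mem_nhdsWithin,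
      Eventually.of_forall fun _ _ _ => refl_mem_uniformity hu⟩
  have hderiv : TendstoLocallyUniformlyOn (fun i w => deriv (F i) (φ w)) (fun w => deriv f (φ w))
      l disc :=
    (hlim.deriv (Eventually.of_forall hF) isOpen_ball).comp φ hφ_maps hφ.continuousOn
  have hintegrand : TendstoLocallyUniformlyOn (fun i w => z * (deriv (F i) (φ w) * g w))
      (fun w => z * (deriv f (φ w) * g w)) l disc :=
    (hconst fun _ => z).fun_mul₀
      (hderiv.fun_mul₀ (hconst g) ((hf.deriv isOpen_ball).continuousOn.comp hφ.continuousOn hφ_maps)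
        hg.continuousOn)
      continuousOn_const (differentiableOn_deriv_comp_mul hg hφ hφ_maps hf).continuousOn
  refine TendstoUniformlyOn.tendsto_intervalIntegral_of_continuousOn
    (Eventually.of_forall fun i => continuousOn_mul_comp_segment
      (differentiableOn_deriv_comp_mul hg hφ hφ_maps (hF i)).continuousOn hz) ?_
  exact (tendstoLocallyUniformlyOn_iff_tendstoUniformlyOn_of_compact isCompact_uIcc).mp
    (hintegrand.comp (fun t : ℝ => (t : ℂ) * z) (mapsTo_segment_disc hz) (by fun_prop))

theorem tendsto_volterraS_dilation {ν : NormalWeight} (hg : DifferentiableOn ℂ g disc)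
    (hφ : DifferentiableOn ℂ φ disc) (hφ_maps : MapsTo φ disc disc) (f : Hinf ν) {z : ℂ}
    (hz : z ∈ disc) :
    Tendsto (fun n => volterraS g φ (Hinf.dilation (radius n) ν f : Hinf ν) z) atTop
      (𝓝 (volterraS g φ f z)) :=
  tendsto_volterraS hg hφ hφ_maps
    (fun n => (Hinf.dilation (radius n) ν f : Hinf ν).differentiableOn) f.differentiableOn
    (tendstoLocallyUniformlyOn_dilation f) hz

end Volterra

section VolterraBidual

variable {ν μ : NormalWeight} {g φ : ℂ → ℂ}

theorem norm_deriv_monomial_le (k : ℕ) {z : ℂ} (hz : z ∈ disc) :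
    ‖deriv (monomial ν k : Hinf ν) z‖ ≤ k := by
  have heq : EqOn (monomial ν k : Hinf ν) (fun z => z ^ k) disc := fun _ => monomial_apply k
  rw [heq.deriv isOpen_ball hz, deriv_pow_field, norm_mul, Complex.norm_natCast]
  exact mul_le_of_le_one_right k.cast_nonneg (norm_pow_le_one_of_mem_disc hz (k - 1))

theorem vanishesAtBoundary_volterraS_monomial (hg : DifferentiableOn ℂ g disc)
    (hφ : DifferentiableOn ℂ φ disc) (hφ_maps : MapsTo φ disc disc)
    (hg0 : VanishesAtBoundary (fun z => (1 - ‖z‖ ^ 2) * μ z) g) (k : ℕ) :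
    VanishesAtBoundary μ (volterraS g φ (monomial ν k : Hinf ν)) := by
  have hk := (monomial ν k : Hinf ν).differentiableOn
  refine NormalWeight.vanishesAtBoundary_of_deriv (differentiableOn_volterraS hg hφ hφ_maps hk)
    (hg0.of_le (fun _ => one_sub_norm_sq_mul_nonneg) (C := k) fun z hz => ?_)
  rw [(hasDerivAt_volterraS hg hφ hφ_maps hk hz).deriv, norm_mul, mul_left_comm]
  exact mul_le_mul_of_nonneg_right (norm_deriv_monomial_le k (hφ_maps hz))
    (mul_nonneg (one_sub_norm_sq_mul_nonneg hz) (norm_nonneg _))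

theorem volterraS_mem_H0 (hg : DifferentiableOn ℂ g disc)
    (hφ : DifferentiableOn ℂ φ disc) (hφ_maps : MapsTo φ disc disc) {S : H0 ν →L[ℂ] Hinf μ}
    (hS : ∀ f : H0 ν, EqOn (S f) (volterraS g φ (f : Hinf ν)) disc)
    (hg0 : VanishesAtBoundary (fun z => (1 - ‖z‖ ^ 2) * μ z) g) (f : H0 ν) : S f ∈ H0 μ := by
  have : IsClosed (H0 μ : Set (Hinf μ)) := isClosed_H0
  have hzero : (H0 μ).mkQL.comp S = 0 := eq_zero_of_forall_apply_monomial_eq_zero fun k =>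
    (Submodule.Quotient.mk_eq_zero _).mpr
      ((vanishesAtBoundary_volterraS_monomial hg hφ hφ_maps hg0 k).congr
        (hS (monomial ν k)).symm)
  exact (Submodule.Quotient.mk_eq_zero _).mp (DFunLike.congr_fun hzero f)

theorem Hinf.tendsto_apply {ι : Type*} {l : Filter ι} {u : ι → Hinf μ} {h : Hinf μ}
    (hu : Tendsto u l (𝓝 h)) {z : ℂ} (hz : z ∈ disc) :
    Tendsto (fun i => u i z) l (𝓝 (h z)) := by
  rw [tendsto_iff_norm_sub_tendsto_zero] at hu ⊢
  refine squeeze_zero (fun _ => norm_nonneg _)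
    (fun i => (u i - h).norm_apply_le (mem_disc.mp hz) le_rfl) ?_
  simpa only [zero_div] using hu.div_const (μ ‖z‖)

/-- The extension `h` is a limit of values of `S`, which is what keeps it in `H^0_μ` when `S` maps
into `H^0_μ`. -/
theorem exists_eqOn_volterraS_of_isCompactOperator (hg : DifferentiableOn ℂ g disc)
    (hφ : DifferentiableOn ℂ φ disc) (hφ_maps : MapsTo φ disc disc) {S : H0 ν →L[ℂ] Hinf μ}
    (hS : ∀ f : H0 ν, EqOn (S f) (volterraS g φ (f : Hinf ν)) disc) (hc : IsCompactOperator S)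
    (f : Hinf ν) :
    ∃ h ∈ closure (range S), EqOn h (volterraS g φ f) disc ∧
      bitranspose S (canonicalBidual ν f) = NormedSpace.inclusionInDoubleDual ℂ (Hinf μ) h := by
  obtain ⟨K, hK, hSK⟩ := IsCompactOperator.image_closedBall_subset_compact
    (f := (S : H0 ν →ₗ[ℂ] Hinf μ)) hc ‖f‖
  obtain ⟨h, -, τ, hτ, hlim⟩ := hK.tendsto_subseq
    (x := fun n => S (Hinf.dilation (radius n) ν f)) fun n =>
      hSK ⟨_, mem_closedBall_zero_iff.mpr (Hinf.norm_dilation_le (radius n) f), rfl⟩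
  refine ⟨h, mem_closure_of_tendsto hlim (Eventually.of_forall fun n => mem_range_self _),
    fun z hz => ?_, ContinuousLinearMap.ext fun l => ?_⟩
  · exact tendsto_nhds_unique (Hinf.tendsto_apply hlim hz)
      (((tendsto_volterraS_dilation hg hφ hφ_maps f hz).comp hτ.tendsto_atTop).congr
        fun n => (hS _ hz).symm)
  · exact tendsto_nhds_unique
      ((tendsto_apply_dilation f (transpose S l)).comp hτ.tendsto_atTop)
      ((l.continuous.tendsto h).comp hlim)

theorem exists_bitranspose_eq_canonicalBidual (hg : DifferentiableOn ℂ g disc)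
    (hφ : DifferentiableOn ℂ φ disc) (hφ_maps : MapsTo φ disc disc) {S : H0 ν →L[ℂ] H0 μ}
    (hS : ∀ f : H0 ν, EqOn (S f : Hinf μ) (volterraS g φ (f : Hinf ν)) disc) (f : Hinf ν) :
    ∃ h : Hinf μ, EqOn h (volterraS g φ f) disc ∧
      bitranspose S (canonicalBidual ν f) = canonicalBidual μ h := by
  obtain ⟨h, hh⟩ := (canonicalBidual μ).surjective (bitranspose S (canonicalBidual ν f))
  refine ⟨h, fun z hz => ?_, hh.symm⟩
  have hhz : canonicalBidual ν f (transpose S (pointEval μ ⟨z, hz⟩)) = h z := by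
    rw [← canonicalBidual_pointEval h ⟨z, hz⟩, hh, bitranspose_apply]
  refine hhz.symm.trans (tendsto_nhds_unique
    (tendsto_apply_dilation f (transpose S (pointEval μ ⟨z, hz⟩))) ?_)
  exact (tendsto_volterraS_dilation hg hφ hφ_maps f hz).congr fun n => (hS _ hz).symm

theorem tfae_isCompactOperator_volterraS (hg : DifferentiableOn ℂ g disc)
    (hφ : DifferentiableOn ℂ φ disc) (hφ_maps : MapsTo φ disc disc) {S : H0 ν →L[ℂ] Hinf μ}
    (hS : ∀ f : H0 ν, EqOn (S f) (volterraS g φ (f : Hinf ν)) disc) :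
    List.TFAE
      [IsCompactOperator S,
       IsWeaklyCompactOperator S,
       ∀ f : Hinf ν, ∃ h : Hinf μ, EqOn h (volterraS g φ f) disc ∧
        bitranspose S (canonicalBidual ν f) =
          NormedSpace.inclusionInDoubleDual ℂ (Hinf μ) h] := by
  tfae_have 1 → 3 := fun hc f => by
    obtain ⟨h, -, hh⟩ := exists_eqOn_volterraS_of_isCompactOperator hg hφ hφ_maps hS hc f
    exact ⟨h, hh⟩
  tfae_have 3 → 2 := fun h => isWeaklyCompactOperator_of_bitranspose_mem_range fun x => by
    obtain ⟨f, rfl⟩ := (canonicalBidual ν).surjective x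
    obtain ⟨y, -, hy⟩ := h f
    exact ⟨y, hy.symm⟩
  tfae_have 2 → 1 := IsWeaklyCompactOperator.isCompactOperator
  tfae_finish

theorem isCompactOperator_iff_forall_memH0_volterraS (hg : DifferentiableOn ℂ g disc)
    (hφ : DifferentiableOn ℂ φ disc) (hφ_maps : MapsTo φ disc disc) {S : H0 ν →L[ℂ] H0 μ}
    (hS : ∀ f : H0 ν, EqOn (S f : Hinf μ) (volterraS g φ (f : Hinf ν)) disc) :
    IsCompactOperator S ↔ ∀ f : Hinf ν, MemH0 μ (volterraS g φ f) := by
  refine ⟨fun hc f => ?_, fun hmem => ?_⟩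
  · obtain ⟨h, hcl, hh, -⟩ := exists_eqOn_volterraS_of_isCompactOperator hg hφ hφ_maps
      (S := (H0 μ).subtypeL.comp S) hS (hc.clm_comp (H0 μ).subtypeL) f
    have hmem : h ∈ H0 μ := closure_minimal (range_subset_iff.mpr fun x => (S x).2) isClosed_H0 hcl
    exact ⟨differentiableOn_volterraS hg hφ hφ_maps f.differentiableOn,
      VanishesAtBoundary.congr hmem hh⟩
  · refine IsWeaklyCompactOperator.isCompactOperator
      (isWeaklyCompactOperator_of_bitranspose_mem_range fun x => ?_)
    obtain ⟨f, rfl⟩ := (canonicalBidual ν).surjective x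
    obtain ⟨h, hh, hbi⟩ := exists_bitranspose_eq_canonicalBidual hg hφ hφ_maps hS f
    have hh0 : h ∈ H0 μ := (hmem f).2.congr hh.symm
    exact ⟨⟨h, hh0⟩, (hbi.trans (canonicalBidual_coe ⟨h, hh0⟩)).symm⟩

/-- The isometry `canonicalBidual` regarded as a topological isomorphism. -/
def canonicalBidualEquiv (ν : NormalWeight) : Hinf ν ≃L[ℂ] Bidual ν :=
  (canonicalBidual ν).toContinuousLinearEquiv

theorem isCanonicalBidual_canonicalBidualEquiv (ν : NormalWeight) :
    IsCanonicalBidual (canonicalBidualEquiv ν) :=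
  canonicalBidual_pointEval

end VolterraBidual

end VolterraComp

end

theorem mainTheorem8 (ν μ : VolterraComp.NormalWeight) (g φ : ℂ → ℂ)
    (hg : DifferentiableOn ℂ g VolterraComp.disc)
    (hφ : DifferentiableOn ℂ φ VolterraComp.disc)
    (hφ_maps : Set.MapsTo φ VolterraComp.disc VolterraComp.disc)
    -- `S_g^φ : H^0_ν → H^∞_μ` is bounded; `S` denotes this bounded operator
    (S : VolterraComp.H0 ν →L[ℂ] VolterraComp.Hinf μ)
    (hS : ∀ f : VolterraComp.H0 ν,
      Set.EqOn (S f) (VolterraComp.volterraS g φ (f : VolterraComp.Hinf ν)) VolterraComp.disc) :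
    -- the canonical identifications `H^∞_ν = (H^0_ν)''` and `H^∞_μ = (H^0_μ)''`
    ∃ (Φν : VolterraComp.Hinf ν ≃L[ℂ] StrongDual ℂ (StrongDual ℂ (VolterraComp.H0 ν)))
      (Φμ : VolterraComp.Hinf μ ≃L[ℂ] StrongDual ℂ (StrongDual ℂ (VolterraComp.H0 μ))),
      VolterraComp.IsCanonicalBidual Φν ∧ VolterraComp.IsCanonicalBidual Φμ ∧
      -- (i)
      List.TFAE
        [IsCompactOperator S,
         VolterraComp.IsWeaklyCompactOperator S,
         ∀ f : VolterraComp.Hinf ν, ∃ h : VolterraComp.Hinf μ,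
          Set.EqOn h (VolterraComp.volterraS g φ f) VolterraComp.disc ∧
          VolterraComp.bitranspose S (Φν f) =
            NormedSpace.inclusionInDoubleDual ℂ (VolterraComp.Hinf μ) h] ∧
      -- (ii)
      (VolterraComp.MemH0 (fun z => (1 - ‖z‖ ^ 2) * μ z) g →
        ∃ S₀ : VolterraComp.H0 ν →L[ℂ] VolterraComp.H0 μ,
          (∀ f : VolterraComp.H0 ν,
            Set.EqOn (S₀ f : VolterraComp.Hinf μ)
              (VolterraComp.volterraS g φ (f : VolterraComp.Hinf ν)) VolterraComp.disc) ∧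
          (∀ f : VolterraComp.Hinf ν, ∃ h : VolterraComp.Hinf μ,
            Set.EqOn h (VolterraComp.volterraS g φ f) VolterraComp.disc ∧
            VolterraComp.bitranspose S₀ (Φν f) = Φμ h) ∧
          (IsCompactOperator S₀ ↔
            ∀ f : VolterraComp.Hinf ν,
              VolterraComp.MemH0 μ (VolterraComp.volterraS g φ f))) := by
  refine ⟨VolterraComp.canonicalBidualEquiv ν, VolterraComp.canonicalBidualEquiv μ,
    VolterraComp.isCanonicalBidual_canonicalBidualEquiv ν,
    VolterraComp.isCanonicalBidual_canonicalBidualEquiv μ,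
    VolterraComp.tfae_isCompactOperator_volterraS hg hφ hφ_maps hS, fun hg0 => ?_⟩
  have hS₀ := VolterraComp.volterraS_mem_H0 hg hφ hφ_maps hS hg0.2
  exact ⟨S.codRestrict (VolterraComp.H0 μ) hS₀, hS,
    VolterraComp.exists_bitranspose_eq_canonicalBidual hg hφ hφ_maps hS,
    VolterraComp.isCompactOperator_iff_forall_memH0_volterraS hg hφ hφ_maps hS⟩
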